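/- Let $k$ be a finite field and $U$ a smooth variety over $k$ (integral, separated and of finite type). A \emph{normal compactification} of $U$ is an open immersion $U\subset X$ over $k$ with $X$ normal and proper over $k$ such that $X\setminus U$ is the support of an effective Cartier divisor on $X$. For an effective Cartier divisor $D$ on $X$ with support $|D|\subset X\setminus U$ and ideal sheaf $I_D=\mathcal O_X(-D)$ put $$C(X,D)=\operatorname{Coker}\Big(\bigoplus_{Z\subset U}k(Z)_D^\times\xrightarrow{\ \operatorname{div}_Z\ }Z_0(U)\Big),$$ where $Z_0(U)$ is the group of zero-cycles on $U$, $Z$ runs through the integral closed curves on $U$, and $$k(Z)_D^\times=\bigcap_{y\in Z_\infty}\operatorname{Ker}\big(\mathcal O_{Z^N,y}^\times\to(\mathcal O_{Z^N,y}/I_D\mathcal O_{Z^N,y})^\times\big)\subset k(Z)^\times .$$ Here $\psi_Z:Z^N\to X$ is the normalization of the closure of $Z$ in $X$ and $Z_\infty=\{y\in Z^N:\psi_Z(y)\notin U\}$. Give $C(X,D)$ the discrete topology and $$C(U\subset X)=\varprojlim_D C(X,D)$$ the inverse limit topology, where $D$ runs through all effective Cartier divisors on $X$ with support in $X\setminus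 U$. \textbf{Lemma.} The topological group $C(U)=C(U\subset X)$ does not depend on the choice of the normal compactification $X$ of $U$: for any two normal compactifications $X_1,X_2$ of $U$ there is a unique isomorphism of topological groups $C(U\subset X_1)\cong C(U\subset X_2)$ that is compatible with the canonical maps from $Z_0(U)$. Moreover, let $f:X_2\to X_1$ be a $k$-morphism between normal compactifications of $U$ which is the identity on $U$. Then for every effective Cartier divisor $D$ on $X_1$ with support in $X_1\setminus U$ the pullback $f^*D$ is an effective Cartier divisor on $X_2$ with support in $X_2\setminus U$, and pushforward of zero-cycles (the identity on $Z_0(U)$) induces an isomorphism $f_*:C(X_2,f^*D)\cong C(X_1,D)$. The divisors $f^*D$ are cofinal among the effective Cartier divisors on $X_2$ with support in $X_2\setminus U$: each of these is $\le f^*D$ for some $D$. The induced map $f_*:C(U\subset X_2)\to C(U\subset X_1)$, $(c_E)_E\mapsto (f_*c_{f^*D})_D$, is an isomorphism of topological groups. -/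

import Mathlib

open CategoryTheory AlgebraicGeometry TopologicalSpace

universe u

noncomputable section

namespace CycleClass

/-! ### Ideal sheaves and effective Cartier divisors -/

/-- The stalk at `x` of the ideal sheaf `I`, as an ideal of the local ring at `x`. -/
def stalkIdeal {X : Scheme.{u}} (I : X.IdealSheafData) (x : X) : Ideal (X.presheaf.stalk x) :=
  ⨆ (V : X.affineOpens) (hV : x ∈ V.1), (I.ideal V).map (X.presheaf.germ V.1 x hV).hom

lemma stalkIdeal_mono {X : Scheme.{u}} {I J : X.IdealSheafData} (h : I ≤ J) (x : X) :
    stalkIdeal I x ≤ stalkIdeal J x :=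
  iSup₂_mono fun V _ => Ideal.map_mono (h V)

/-- `I` is the ideal sheaf `𝒪(-D)` of an effective Cartier divisor `D`: locally it is generated
by one nonzerodivisor. -/
def IsEffectiveCartier {X : Scheme.{u}} (I : X.IdealSheafData) : Prop :=
  ∀ x : X, ∃ V : X.affineOpens, x ∈ V.1 ∧
    ∃ g ∈ nonZeroDivisors Γ(X, V.1), I.ideal V = Ideal.span {g}

/-! ### Zero-cycles, curves on `U`, and divisors of rational functions on curves -/

/-- The group of zero-cycles: the free abelian group on the closed points. -/
abbrev ZeroCycle (U : Scheme.{u}) : Type u := {x : U // IsClosed ({x} : Set U)} →₀ ℤ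

/-- An integral closed curve on `U`. -/
structure IntegralCurve (U : Scheme.{u}) where
  Z : Scheme.{u}
  incl : Z ⟶ U
  isClosedImmersion : IsClosedImmersion incl
  isIntegral : IsIntegral Z
  dim_eq_one : topologicalKrullDim Z = 1

attribute [instance] IntegralCurve.isClosedImmersion IntegralCurve.isIntegral

/-- A nonzero rational function on a Noetherian integral scheme has only finitely many zeros and
poles. -/
lemma finite_support_ord (Z : Scheme.{u}) [IsIntegral Z] [IsNoetherian Z] (g : Z.functionFieldˣ) :
    (Function.support (Z.ord (g : Z.functionField))).Finite := by
  classical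
  obtain ⟨V, -, g', hV, hg, hu⟩ := exists_isUnit_germ_eq Z (g : Z.functionField) g.ne_zero
  obtain ⟨S, hS, hcl, hirr, hsup⟩ :=
    NoetherianSpace.exists_finite_set_isClosed_irreducible V.isOpen.isClosed_compl
  refine (hS.image fun t : Set Z => if h : IsIrreducible t then h.genericPoint
    else genericPoint Z).subset fun p hp => ?_
  have hp1 : Order.coheight p = 1 := by
    by_contra h
    exact hp (Scheme.ord_eq_zero_of_coheight_neq_one h _)
  have hpV : p ∈ ((V : Set Z)ᶜ) := fun h => hp (by rw [← hg]; exact Scheme.ord_of_isUnit hu h)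
  rw [hsup] at hpV
  obtain ⟨t, ht, hpt⟩ := hpV
  refine ⟨t, ht, ?_⟩
  have hi := hirr t ht
  simp only [dif_pos hi]
  set q := hi.genericPoint with hq
  have hqt : IsGenericPoint q t := hi.isGenericPoint_genericPoint (hcl t ht)
  have hqp : q ⤳ p := hqt.specializes hpt
  have hqV : q ∉ V := by
    have h : q ∈ ((V : Set Z)ᶜ) := by
      rw [hsup]
      exact ⟨t, ht, hqt.mem⟩
    exact h
  have hη : genericPoint Z ∈ V :=
    ((genericPoint_spec Z).mem_open_set_iff V.isOpen).mpr (by simpa using hV)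
  by_contra hne
  have h1 : p < q := ⟨hqp, fun h => hne (hqp.antisymm h).eq⟩
  have h2 : q < genericPoint Z :=
    ⟨genericPoint_specializes q, fun h => hqV (h.mem_open V.isOpen hη)⟩
  have h3 := Order.coheight_add_one_le h1
  have h4 := Order.coheight_add_one_le h2
  rw [hp1] at h3
  have h5 : Order.coheight q = 0 := by
    by_contra h
    have : 1 ≤ Order.coheight q := Order.one_le_iff_ne_zero.mpr h
    have := (add_le_add_left this 1).trans h3
    exact absurd this (by decide)
  rw [h5] at h4
  exact absurd h4 (by simp)

/-- A closed curve on a scheme of finite type over a field is Noetherian. -/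
lemma IntegralCurve.isNoetherian {k : Type u} [Field k] {U : Scheme.{u}}
    (s : U ⟶ Spec (.of k)) [LocallyOfFiniteType s] [QuasiCompact s] (C : IntegralCurve U) :
    IsNoetherian C.Z := by
  have h1 : IsLocallyNoetherian C.Z := LocallyOfFiniteType.isLocallyNoetherian (C.incl ≫ s)
  have h2 : CompactSpace C.Z := QuasiCompact.compactSpace_of_compactSpace (C.incl ≫ s)
  exact { }

section Divisor

variable {U : Scheme.{u}} (C : IntegralCurve U) [IsNoetherian C.Z]

instance (x : U) : Subsingleton {p : C.Z // C.incl p = x} :=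
  ⟨fun p q => Subtype.ext (C.incl.isEmbedding.injective (p.2.trans q.2.symm))⟩

/-- The function `x ↦ ord_x g` on the closed points of `U`; it vanishes off the curve. -/
def ordAt (g : C.Z.functionFieldˣ) (x : {x : U // IsClosed ({x} : Set U)}) : ℤ :=
  ∑ᶠ p : {p : C.Z // C.incl p = x.1}, C.Z.ord (g : C.Z.functionField) p.1

lemma finite_support_ordAt (g : C.Z.functionFieldˣ) : (Function.support (ordAt C g)).Finite := by
  refine Set.Finite.of_finite_image (f := Subtype.val) ?_ Subtype.val_injective.injOn
  refine ((finite_support_ord C.Z g).image C.incl).subset ?_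
  rintro _ ⟨x, hx, rfl⟩
  by_contra hne
  refine hx (finsum_eq_zero_of_forall_eq_zero fun p => ?_)
  by_contra hp
  exact hne ⟨p.1, hp, p.2⟩

/-- The divisor map `div_Z : k(Z)ˣ → Z₀(U)` of the curve `Z`. -/
def divisor : Additive C.Z.functionFieldˣ →+ ZeroCycle U where
  toFun g := Finsupp.ofSupportFinite (ordAt C g.toMul) (finite_support_ordAt C _)
  map_zero' := by
    ext x
    have h1 : C.Z.ord (1 : C.Z.functionField) = 0 := by
      ext p
      have := Scheme.ord_mul (x := p) (one_ne_zero (α := C.Z.functionField)) one_ne_zero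
      simp only [mul_one] at this
      simpa using this
    simp [Finsupp.ofSupportFinite, ordAt, h1]
  map_add' g h := by
    ext x
    change ordAt C (g.toMul * h.toMul) x = ordAt C g.toMul x + ordAt C h.toMul x
    simp only [ordAt, Units.val_mul]
    rw [← finsum_add_distrib (Set.toFinite _) (Set.toFinite _)]
    exact finsum_congr fun p => Scheme.ord_mul g.toMul.ne_zero h.toMul.ne_zero

end Divisor

/-! ### Compactifications and the normalizations of the closures of curves -/

/-- A normal compactification of the `k`-scheme `U`: an open immersion into a proper normal
`k`-scheme `X` such that the complement is the support of an effective Cartier divisor. -/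
structure NormalCompactification {k : Type u} [Field k] {U : Scheme.{u}}
    (s : U ⟶ Spec (.of k)) where
  X : Scheme.{u}
  str : X ⟶ Spec (.of k)
  incl : U ⟶ X
  isProper : IsProper str
  isDomain_stalk : ∀ x : X, IsDomain (X.presheaf.stalk x)
  isIntegrallyClosed_stalk : ∀ x : X, IsIntegrallyClosed (X.presheaf.stalk x)
  isOpenImmersion : IsOpenImmersion incl
  incl_comp_str : incl ≫ str = s
  boundary : ∃ I : X.IdealSheafData, IsEffectiveCartier I ∧
    (I.support : Set X) = (Set.range incl)ᶜ

attribute [instance] NormalCompactification.isProper NormalCompactification.isOpenImmersion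

namespace NormalCompactification

variable {k : Type u} [Field k] {U : Scheme.{u}} {s : U ⟶ Spec (.of k)}
variable (X : NormalCompactification s) (C : IntegralCurve U)

/-- The morphism `Spec k(Z) → Z → U → X`. -/
def fromSpecFunctionField : Spec C.Z.functionField ⟶ X.X :=
  C.Z.fromSpecStalk (genericPoint C.Z) ≫ C.incl ≫ X.incl

instance : QuasiCompact (X.fromSpecFunctionField C) :=
  QuasiCompact.of_comp _ X.str

instance : QuasiSeparated (X.fromSpecFunctionField C) :=
  QuasiSeparated.of_comp _ X.str

/-- The normalization `Z^N` of the closure of `Z` in `X`, constructed as the normalization of `X`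
in the function field `k(Z)`. -/
def curveNormalization : Scheme.{u} := (X.fromSpecFunctionField C).normalization

/-- The map `ψ_Z : Z^N → X`. -/
def psi : X.curveNormalization C ⟶ X.X := (X.fromSpecFunctionField C).fromNormalization

/-- The inclusion of the generic point `Spec k(Z) → Z^N`. -/
def generic : Spec C.Z.functionField ⟶ X.curveNormalization C :=
  (X.fromSpecFunctionField C).toNormalization

lemma generic_specializes (y : X.curveNormalization C) :
    X.generic C (IsLocalRing.closedPoint C.Z.functionField) ⤳ y := by
  have h : DenseRange (X.generic C) :=
    (inferInstance : IsDominant (X.fromSpecFunctionField C).toNormalization).denseRange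
  rw [specializes_iff_mem_closure]
  have hr : Set.range (X.generic C) =
      {X.generic C (IsLocalRing.closedPoint C.Z.functionField)} := by
    have : Subsingleton (Spec C.Z.functionField) :=
      inferInstanceAs (Subsingleton (PrimeSpectrum C.Z.functionField))
    ext z
    constructor
    · rintro ⟨w, rfl⟩
      rw [Subsingleton.elim w (IsLocalRing.closedPoint C.Z.functionField)]
      rfl
    · rintro rfl
      exact ⟨_, rfl⟩
  rw [← hr]
  exact h y

/-- The inclusion of the local ring `𝒪_{Z^N,y}` into the function field `k(Z)`. -/
def stalkToFunctionField (y : X.curveNormalization C) :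
    (X.curveNormalization C).presheaf.stalk y →+* C.Z.functionField :=
  ((X.curveNormalization C).presheaf.stalkSpecializes (X.generic_specializes C y) ≫
    Scheme.stalkClosedPointTo (X.generic C)).hom

/-- The set `Z_∞` of points of `Z^N` that do not lie over `U`. -/
def pointsAtInfinity : Set (X.curveNormalization C) :=
  {y | X.psi C y ∉ Set.range X.incl}

/-- The ideal `I_D 𝒪_{Z^N,y}` generated by the ideal sheaf `I_D` on `X`. -/
def idealAt (I : X.X.IdealSheafData) (y : X.curveNormalization C) :
    Ideal ((X.curveNormalization C).presheaf.stalk y) :=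
  (stalkIdeal I (X.psi C y)).map ((X.psi C).stalkMap y).hom

/-- The congruence subgroup `k(Z)_Dˣ`: the intersection over `y ∈ Z_∞` of the kernels of
`𝒪_{Z^N,y}ˣ → (𝒪_{Z^N,y} / I_D 𝒪_{Z^N,y})ˣ`, as subgroups of `k(Z)ˣ`. -/
def congruenceSubgroup (I : X.X.IdealSheafData) : Subgroup C.Z.functionFieldˣ :=
  ⨅ y ∈ X.pointsAtInfinity C,
    (Units.map (Ideal.Quotient.mk (X.idealAt C I y)).toMonoidHom).ker.map
      (Units.map (X.stalkToFunctionField C y).toMonoidHom)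

lemma congruenceSubgroup_mono {I J : X.X.IdealSheafData} (h : I ≤ J) :
    X.congruenceSubgroup C I ≤ X.congruenceSubgroup C J := by
  refine iInf₂_mono fun y _ => Subgroup.map_mono fun v hv => ?_
  rw [MonoidHom.mem_ker, Units.ext_iff] at hv ⊢
  have h1 : Ideal.Quotient.mk (X.idealAt C I y) (v : _) = 1 := hv
  change Ideal.Quotient.mk (X.idealAt C J y) (v : _) = 1
  rw [← map_one (Ideal.Quotient.mk _), Ideal.Quotient.eq] at h1 ⊢
  exact Ideal.map_mono (stalkIdeal_mono h _) h1

/-! ### The relative Chow groups and the class group -/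

/-- An effective Cartier divisor on `X` with support in `X ∖ U`, given by its ideal sheaf. -/
structure BoundaryDivisor where
  ideal : X.X.IdealSheafData
  isEffectiveCartier : IsEffectiveCartier ideal
  support_subset : (ideal.support : Set X.X) ⊆ (Set.range X.incl)ᶜ

/-- `D ≤ E` if `E - D` is effective, that is, if `𝒪(-E) ⊆ 𝒪(-D)`. -/
instance : Preorder X.BoundaryDivisor where
  le D E := E.ideal ≤ D.ideal
  le_refl _ := le_rfl
  le_trans _ _ _ h₁ h₂ := h₂.trans h₁

variable [LocallyOfFiniteType s] [QuasiCompact s]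

variable {X} in
/-- The subgroup of `Z₀(U)` generated by the divisors of the functions in `k(Z)_Dˣ`, where `Z` runs
through the integral closed curves on `U`. -/
def relations (D : X.BoundaryDivisor) : AddSubgroup (ZeroCycle U) :=
  ⨆ C : IntegralCurve U,
    haveI := C.isNoetherian s
    (Subgroup.toAddSubgroup (X.congruenceSubgroup C D.ideal)).map (divisor C)

variable {X} in
lemma relations_anti {D E : X.BoundaryDivisor} (h : D ≤ E) : relations E ≤ relations D :=
  iSup_mono fun C => AddSubgroup.map_mono (X.congruenceSubgroup_mono C h)

variable {X} in
/-- The relative Chow group of zero-cycles `C(X,D)`. -/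
def RelChow (D : X.BoundaryDivisor) : Type u := ZeroCycle U ⧸ relations D

namespace RelChow

variable {X}

instance (D : X.BoundaryDivisor) : AddCommGroup (RelChow D) :=
  inferInstanceAs (AddCommGroup (ZeroCycle U ⧸ relations D))

/-- `C(X,D)` carries the discrete topology. -/
instance (D : X.BoundaryDivisor) : TopologicalSpace (RelChow D) := ⊥

instance (D : X.BoundaryDivisor) : DiscreteTopology (RelChow D) := ⟨rfl⟩

/-- The class in `C(X,D)` of a zero-cycle on `U`. -/
def mk (D : X.BoundaryDivisor) : ZeroCycle U →+ RelChow D := QuotientAddGroup.mk' (relations D)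

/-- The canonical map `C(X,E) → C(X,D)` for `D ≤ E`. -/
def transition {D E : X.BoundaryDivisor} (h : D ≤ E) : RelChow E →+ RelChow D :=
  QuotientAddGroup.map (relations E) (relations D) (AddMonoidHom.id _) (relations_anti h)

end RelChow

/-- The class group `C(U ⊂ X) = lim_D C(X,D)`, with the inverse limit topology (the topology
induced by the product of the discrete groups `C(X,D)`). -/
def ClassGroup : AddSubgroup ((D : X.BoundaryDivisor) → RelChow D) where
  carrier := {c | ∀ ⦃D E : X.BoundaryDivisor⦄ (h : D ≤ E), RelChow.transition h (c E) = c D}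
  zero_mem' _ _ _ := map_zero _
  add_mem' ha hb _ _ h := (map_add _ _ _).trans (congrArg₂ _ (ha h) (hb h))
  neg_mem' ha _ _ h := (map_neg _ _).trans (congrArg _ (ha h))

/-- The canonical map `Z₀(U) → C(U ⊂ X)`. -/
def cycleClass : ZeroCycle U →+ X.ClassGroup where
  toFun z := ⟨fun D => RelChow.mk D z, fun _ _ _ => rfl⟩
  map_zero' := Subtype.ext (funext fun _ => map_zero _)
  map_add' _ _ := Subtype.ext (funext fun _ => map_add _ _ _)

end NormalCompactification

end CycleClass

end

/-! All the groups `C(X,D)` are quotients of the same group `Z₀(U)`, so everything reduces to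
comparing the relation subgroups for different `X` and `D`.

Let `T` be a proper `k`-scheme that contains `U` and maps to `X₁` and `X₂`. Let `Z` be a curve on
`U` and `y` a point at infinity of its normalization over `X₁`. The local ring at `y` is integrally
closed in `k(Z)`, is not a field and contains `k`; since `k(Z)` has transcendence degree at most
one, it is a valuation ring of `k(Z)` (`valuationRing_stalk`). The valuative criterion lifts its
spectrum to `T`, and then to the normalization of the curve over `X₂`. The closed point lands at a
point at infinity there, whose local ring therefore maps into the one at `y`, inside `k(Z)`. Hence
`I₂ 𝒪_T ⊆ I₁ 𝒪_T` implies that the congruence subgroup of `I₂` lies in that of `I₁`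
(`congruenceSubgroup_le_of_comap_le`).

Take for `T` the scheme-theoretic image of `U` in `X₁ × X₂`. By density and separatedness both
projections have the same preimage of `U` (`mem_range_incl_of_mem_range_incl`), so by
quasi-compactness some multiple of the boundary of `X₂` dominates a given `D` on `T`. The relation
subgroups of `X₁` and `X₂` are thus mutually cofinal (`exists_relations_le`), and the limits agree.
Uniqueness holds because `Z₀(U)` is dense in the limit (`denseRange_cycleClass`). For a morphism `f`
one takes `T = X₂`: there `D` and `f^*D` have the same ideal, so their relations coincide
(`relations_pullback`). -/

noncomputable section

namespace CycleClass

/-! ### Integrally closed local rings in fields of transcendence degree one -/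

open Polynomial in
/-- If `x` is a root of a polynomial over an integrally closed local ring with some unit
coefficient, then `x` or `x⁻¹` lies in the ring. -/
lemma mem_range_or_inv_mem_range_of_aeval_eq_zero {R K : Type*} [CommRing R] [IsLocalRing R]
    [Field K] [Algebra R K] (hR : ∀ x : K, IsIntegral R x → x ∈ (algebraMap R K).range) (x : K)
    (p : R[X]) (hp : aeval x p = 0) (i : ℕ) (hi : IsUnit (p.coeff i)) :
    x ∈ (algebraMap R K).range ∨ x⁻¹ ∈ (algebraMap R K).range := by
  induction h : p.natDegree using Nat.strong_induction_on generalizing p i with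
  | _ n ih =>
  by_cases hn : n = 0
  · subst hn
    obtain ⟨a, rfl⟩ := natDegree_eq_zero.mp h
    rw [aeval_C] at hp
    obtain rfl | hi0 := eq_or_ne i 0
    · rw [coeff_C_zero] at hi
      exact absurd hp (hi.map _).ne_zero
    · rw [coeff_C_of_ne_zero hi0] at hi
      exact absurd hi not_isUnit_zero
  -- With `a` the leading coefficient, `a * x` is integral and equals some `b` in `R`. If `b` or `a`
  -- is a unit, then `x⁻¹ = a / b` or `x = b / a` lies in `R`.
  obtain ⟨b, hb⟩ := hR _ (isIntegral_leadingCoeff_smul p x hp)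
  rw [Algebra.smul_def] at hb
  by_cases hbu : IsUnit b
  · right
    obtain ⟨c, hc⟩ := hbu.exists_right_inv
    refine ⟨p.leadingCoeff * c, ?_⟩
    have h1 : algebraMap R K b * algebraMap R K c = 1 := by rw [← map_mul, hc, map_one]
    rw [hb] at h1
    rw [map_mul]
    refine (inv_eq_of_mul_eq_one_left ?_).symm
    rw [← h1]; ring
  by_cases hlu : IsUnit p.leadingCoeff
  · left
    obtain ⟨c, hc⟩ := hlu.exists_right_inv
    refine ⟨b * c, ?_⟩
    have h1 : algebraMap R K p.leadingCoeff * algebraMap R K c = 1 := by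
      rw [← map_mul, hc, map_one]
    rw [map_mul, hb, mul_right_comm, h1, one_mul]
  -- Replacing `a * x ^ n` by `b * x ^ (n - 1)` lowers the degree and keeps the root. At most the
  -- coefficient `n - 1` changes, and by a nonunit, so the coefficient `i` stays a unit.
  set q : R[X] := p.eraseLead + C b * X ^ (n - 1) with hq
  have hq0 : aeval x q = 0 := by
    have h1 := p.eraseLead_add_C_mul_X_pow
    rw [← h1, map_add, map_mul, aeval_C, map_pow, aeval_X, h] at hp
    rw [hq, map_add, map_mul, aeval_C, map_pow, aeval_X, hb, mul_assoc, ← pow_succ',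
      Nat.sub_add_cancel (Nat.pos_of_ne_zero hn), hp]
  have hqd : q.natDegree < n := by
    refine lt_of_le_of_lt (natDegree_add_le _ _) (max_lt ?_ ?_)
    · have := p.eraseLead_natDegree_le
      omega
    · exact lt_of_le_of_lt (natDegree_C_mul_X_pow_le _ _) (by omega)
  have hin : i ≠ n := by
    rintro rfl
    exact hlu (by rwa [leadingCoeff, h])
  have hqi : IsUnit (q.coeff i) := by
    rw [hq, coeff_add, eraseLead_coeff_of_ne _ (by rwa [h]), coeff_C_mul, coeff_X_pow]
    split_ifs with h1
    · by_contra hc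
      have hm := IsLocalRing.nonunits_add (a := p.coeff i + b * 1) (b := -(b * 1)) hc
        (by simpa using hbu)
      simp only [add_neg_cancel_right] at hm
      exact hm hi
    · simpa using hi
  exact ih _ hqd q hq0 i hqi rfl

open Polynomial in
/-- A local ring that is integrally closed in a field of transcendence degree at most one over a
field `k` contained in the ring, and that is not a field, is a valuation ring of this field. -/
lemma mem_range_or_inv_mem_range_of_trdeg_le_one {k R K : Type u} [Field k] [CommRing R]
    [IsLocalRing R] [Field K] [Algebra k R] [Algebra R K] [Algebra k K] [IsScalarTower k R K]
    (hR : ∀ x : K, IsIntegral R x → x ∈ (algebraMap R K).range)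
    (hinj : Function.Injective (algebraMap R K)) (hf : ¬ IsField R)
    (htr : Algebra.trdeg k K ≤ 1) (x : K) :
    x ∈ (algebraMap R K).range ∨ x⁻¹ ∈ (algebraMap R K).range := by
  have : Nontrivial R := inferInstance
  obtain ⟨t, ht0, htu⟩ : ∃ t : R, t ≠ 0 ∧ ¬ IsUnit t := by
    obtain ⟨I, hI0, hI1⟩ := Ring.not_isField_iff_exists_ideal_bot_lt_and_lt_top.mp hf
    obtain ⟨t, htI, ht0⟩ := (Submodule.ne_bot_iff I).mp hI0.ne'
    exact ⟨t, ht0, fun hu => hI1.ne (I.eq_top_of_isUnit_mem htI hu)⟩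
  -- An algebraic nonzero element of a domain over `k` is a unit, which `t` is not. So `t` is a
  -- transcendence basis and `K` is algebraic over `k[t]`.
  have htr' : Transcendental k (algebraMap R K t) := by
    intro halg
    have h2 : IsAlgebraic k t := (isAlgebraic_algebraMap_iff hinj).mp halg
    have h3 : IsIntegral k t := h2.isIntegral
    have : IsDomain R := hinj.isDomain _
    exact htu (h3.isUnit ht0)
  let φ : k[X] →ₐ[k] K := aeval (algebraMap R K t)
  let := φ.toRingHom.toAlgebra
  have hφ : Function.Injective (algebraMap k[X] K) := transcendental_iff_injective.mp htr'
  have : FaithfulSMul k[X] K := (faithfulSMul_iff_algebraMap_injective _ _).mpr hφ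
  have : IsScalarTower k k[X] K := .of_algebraMap_eq' φ.comp_algebraMap.symm
  have h0 : Algebra.trdeg k[X] K = 0 := by
    have h1 := trdeg_add_eq (R := k) (S := k[X]) (A := K)
    rw [Polynomial.trdeg_of_isDomain] at h1
    rw [← h1] at htr
    have h2 : (1 : Cardinal) + Algebra.trdeg k[X] K ≤ 1 + 0 := by simpa using htr
    exact le_antisymm ((Cardinal.add_le_add_iff_of_lt_aleph0 Cardinal.one_lt_aleph0).mp
      (by simpa [add_comm] using h2)) zero_le
  have halg : Algebra.IsAlgebraic k[X] K := trdeg_eq_zero_iff.mp h0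
  obtain ⟨Q, hQ0, hQ⟩ := halg.isAlgebraic x
  let : NormalizedGCDMonoid k[X] := Classical.choice inferInstance
  have hprim := Q.isPrimitive_primPart
  have hQ' : aeval x Q.primPart = 0 := by
    rw [Q.eq_C_content_mul_primPart, map_mul, aeval_C] at hQ
    refine (mul_eq_zero.mp hQ).resolve_left ?_
    rw [map_eq_zero_iff _ hφ, content_eq_zero_iff]
    exact hQ0
  -- This coefficient has nonzero constant term, so evaluated at `t` it is a unit of `k` plus a
  -- multiple of the nonunit `t`, hence a unit of `R`.
  obtain ⟨i, hi⟩ : ∃ i, ¬ (X ∣ Q.primPart.coeff i) := by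
    by_contra! hall
    exact Polynomial.not_isUnit_X (hprim X ((C_dvd_iff_dvd_coeff _ _).mpr hall))
  let ψ : k[X] →+* R := (aeval t : k[X] →ₐ[k] R).toRingHom
  have hψ : (algebraMap R K).comp ψ = algebraMap k[X] K := by
    refine Polynomial.ringHom_ext' ?_ ?_
    · ext a
      change algebraMap R K (aeval t (C a)) = aeval (algebraMap R K t) (C a)
      simp [← IsScalarTower.algebraMap_apply]
    · change algebraMap R K (aeval t X) = aeval (algebraMap R K t) X
      simp
  refine mem_range_or_inv_mem_range_of_aeval_eq_zero hR x (Q.primPart.map ψ) ?_ i ?_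
  · rw [aeval_def, eval₂_map, hψ]
    exact hQ'
  · rw [coeff_map]
    rw [X_dvd_iff] at hi
    obtain ⟨g, hg⟩ : X ∣ Q.primPart.coeff i - C ((Q.primPart.coeff i).coeff 0) := by
      rw [X_dvd_iff]; simp
    rw [sub_eq_iff_eq_add] at hg
    rw [hg, map_add, map_mul]
    have h1 : ψ X = t := by simp [ψ]
    have h2 : ψ (C ((Q.primPart.coeff i).coeff 0)) = algebraMap k R ((Q.primPart.coeff i).coeff 0) := by
      simp [ψ]
    rw [h1, h2]
    by_contra hc
    have h3 := IsLocalRing.nonunits_add (b := -(t * ψ g)) hc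
      (by simpa using fun hu : IsUnit (t * ψ g) => htu (isUnit_of_mul_isUnit_left hu))
    rw [add_comm (t * ψ g), add_neg_cancel_right] at h3
    exact h3 ((IsUnit.mk0 _ hi).map _)

/-- Form with explicit ring homomorphisms, suited to stalk maps. That `K` is a field enters as a
proposition, so its given ring structure is kept. -/
lemma valuationRing_and_isFractionRing_of_trdeg_le_one {k R K : Type u} [Field k] [CommRing R]
    [IsLocalRing R] [IsDomain R] [CommRing K] (hK : IsField K) (φ : k →+* R) (σ : R →+* K)
    (hσ : ∀ x : K, σ.IsIntegralElem x → x ∈ σ.range) (hinj : Function.Injective σ)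
    (hf : ¬ IsField R) (htr : @Algebra.trdeg k K _ _ (σ.comp φ).toAlgebra ≤ 1) :
    ValuationRing R ∧ @IsFractionRing R _ K _ σ.toAlgebra := by
  let := hK.toField
  let := φ.toAlgebra
  let := σ.toAlgebra
  let := (σ.comp φ).toAlgebra
  have : IsScalarTower k R K := .of_algebraMap_eq' rfl
  have h := mem_range_or_inv_mem_range_of_trdeg_le_one (k := k) (R := R) (K := K) hσ hinj hf htr
  have : FaithfulSMul R K := (faithfulSMul_iff_algebraMap_injective _ _).mpr hinj
  have hF : IsFractionRing R K := by
    refine IsFractionRing.of_field R K fun z => ?_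
    obtain ⟨x, hx⟩ | ⟨x, hx⟩ := h z
    · exact ⟨x, 1, by rw [map_one, div_one, hx]⟩
    · exact ⟨1, x, by rw [map_one, hx, one_div, inv_inv]⟩
  exact ⟨(ValuationRing.iff_isInteger_or_isInteger R K).mpr h, hF⟩

/-- Lying over lifts the bottom of a chain of primes, and going up lifts the rest. -/
lemma ringKrullDim_le_of_isIntegral_of_injective {R S : Type*} [CommRing R] [CommRing S]
    [Algebra R S] [Algebra.IsIntegral R S] (h : Function.Injective (algebraMap R S)) :
    ringKrullDim R ≤ ringKrullDim S := by
  refine iSup_le fun l => ?_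
  obtain ⟨P, hP, hP'⟩ := Ideal.exists_ideal_over_prime_of_isIntegral l.head.asIdeal (⊥ : Ideal S)
    (by rw [← RingHom.ker_eq_comap_bot, (RingHom.injective_iff_ker_eq_bot _).mp h]; exact bot_le)
  have : P.LiesOver l.head.asIdeal := ⟨hP'.2.symm⟩
  have : P.IsPrime := hP'.1
  obtain ⟨L, hL, -⟩ := Ideal.exists_ltSeries_of_hasGoingUp (S := S) l P
  rw [← hL]
  exact le_iSup (fun L : LTSeries (PrimeSpectrum S) => (L.length : WithBot ℕ∞)) L

/-- The fraction field of a finitely generated domain of dimension at most one has transcendence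
degree at most one. -/
lemma trdeg_le_one_of_ringKrullDim_le_one {k A K : Type u} [Field k] [CommRing A] [IsDomain A]
    [CommRing K] [IsDomain K] [Algebra k A] [Algebra A K] [Algebra k K] [IsScalarTower k A K]
    [Algebra.FiniteType k A] [IsFractionRing A K] (h : ringKrullDim A ≤ 1) :
    Algebra.trdeg k K ≤ 1 := by
  -- Noether normalization: the number `s` of variables is at most the dimension of `A`, and it is
  -- also the transcendence degree.
  obtain ⟨s, g, hg, hint⟩ := exists_integral_inj_algHom_of_fg k A
  algebraize [g.toRingHom]
  have : IsScalarTower k (MvPolynomial (Fin s) k) A := .of_algebraMap_eq' g.comp_algebraMap.symm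
  have h1 := ringKrullDim_le_of_isIntegral_of_injective hg
  rw [MvPolynomial.ringKrullDim_of_isNoetherianRing, ringKrullDim_eq_zero_of_field] at h1
  have h2 : s ≤ 1 := by
    have := h1.trans h
    simpa using this
  have : FaithfulSMul (MvPolynomial (Fin s) k) A := (faithfulSMul_iff_algebraMap_injective _ _).mpr hg
  have h3 := trdeg_add_eq (R := k) (S := MvPolynomial (Fin s) k) (A := A)
  have h4 := trdeg_add_eq (R := k) (S := A) (A := K)
  have : Algebra.IsAlgebraic A K := IsLocalization.isAlgebraic K (nonZeroDivisors A)
  have : Algebra.IsAlgebraic (MvPolynomial (Fin s) k) A := inferInstance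
  rw [trdeg_eq_zero (R := MvPolynomial (Fin s) k), add_zero] at h3
  rw [trdeg_eq_zero (R := A), add_zero] at h4
  rw [← h4, ← h3, MvPolynomial.trdeg_of_isDomain]
  simpa using h2

/-! ### Pullbacks, supports and stalks of ideal sheaves -/

open Limits in
-- For `≤`, the affine scheme `Spec (Γ(X, W) / J)` maps to `Y` through the subscheme of `I`, so by
-- adjunction `I.comap f` lies in the kernel of its map to `X`. For `≥`, sections of `I` vanish on
-- the subscheme of `I.comap f`.
lemma ideal_comap_of_le {X Y : Scheme.{u}} (I : Y.IdealSheafData) (f : X ⟶ Y) (V : Y.affineOpens)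
    (W : X.affineOpens) (h : W.1 ≤ f ⁻¹ᵁ V.1) :
    (I.comap f).ideal W = (I.ideal V).map (f.appLE V.1 W.1 h).hom := by
  have hV : IsAffineOpen V.1 := V.2
  have hW : IsAffineOpen W.1 := W.2
  apply le_antisymm
  · set J := (I.ideal V).map (f.appLE V.1 W.1 h).hom with hJ
    let q : Spec (.of (Γ(X, W.1) ⧸ J)) ⟶ X :=
      Spec.map (CommRingCat.ofHom (Ideal.Quotient.mk J)) ≫ hW.fromSpec
    let a : Γ(Y, V.1) ⧸ I.ideal V →+* Γ(X, W.1) ⧸ J :=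
      Ideal.quotientMap J (f.appLE V.1 W.1 h).hom Ideal.le_comap_map
    have hq : q ≫ f = (Spec.map (CommRingCat.ofHom a) ≫ I.subschemeCover.f V) ≫ I.subschemeι := by
      have h1 : I.subschemeCover.f V ≫ I.subschemeι =
          Spec.map (CommRingCat.ofHom (Ideal.Quotient.mk (I.ideal V))) ≫ hV.fromSpec := by
        rw [I.subschemeCover_map_subschemeι]
        exact Category.assoc _ _ _
      have h3 := IsAffineOpen.SpecMap_appLE_fromSpec f hV hW h
      have h4 : Spec.map (CommRingCat.ofHom (Ideal.Quotient.mk J)) ≫ Spec.map (f.appLE V.1 W.1 h) =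
          Spec.map (CommRingCat.ofHom a) ≫
            Spec.map (CommRingCat.ofHom (Ideal.Quotient.mk (I.ideal V))) := by
        rw [← Spec.map_comp, ← Spec.map_comp]
        rfl
      refine (Category.assoc _ _ _).trans ?_
      refine Eq.trans ?_ (Category.assoc _ _ _).symm
      refine (congrArg _ h3.symm).trans (Eq.trans ?_ (congrArg _ h1).symm)
      exact (Category.assoc _ _ _).symm.trans (congr($h4 ≫ hV.fromSpec).trans
        (Category.assoc _ _ _))
    have h2 : I.comap f ≤ q.ker := by
      rw [← Scheme.IdealSheafData.le_map_iff_comap_le, Scheme.IdealSheafData.map_ker, hq]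
      exact I.ker_subschemeι.ge.trans (Scheme.Hom.le_ker_comp _ _)
    intro x hx
    have h3 := q.ideal_ker_le W (h2 W hx)
    rw [RingHom.mem_ker] at h3
    have hle : (⊤ : (Spec (.of (Γ(X, W.1) ⧸ J))).Opens) ≤ q ⁻¹ᵁ W.1 := by
      rw [Scheme.Hom.comp_preimage, hW.fromSpec_preimage_self]
      exact le_rfl
    have h4 : q.appLE W.1 ⊤ hle =
        CommRingCat.ofHom (Ideal.Quotient.mk J) ≫ (Scheme.ΓSpecIso _).inv := by
      rw [← Scheme.Hom.appLE_comp_appLE _ hW.fromSpec W.1 ⊤ ⊤ hW.fromSpec_preimage_self.ge le_rfl]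
      have h7 : hW.fromSpec.appLE W.1 ⊤ hW.fromSpec_preimage_self.ge =
          (Scheme.ΓSpecIso Γ(X, W.1)).inv := by
        rw [Scheme.Hom.appLE, hW.fromSpec_app_self, Category.assoc, ← Functor.map_comp, ← op_comp]
        refine (congrArg _ ((Spec Γ(X, W.1)).presheaf.map_id _)).trans (Category.comp_id _)
      rw [h7]
      have h8 := Scheme.ΓSpecIso_inv_naturality (CommRingCat.ofHom (Ideal.Quotient.mk J))
      rw [Scheme.Hom.appTop, Scheme.Hom.app_eq_appLE] at h8
      exact h8.symm
    have h5 : (q.appLE W.1 ⊤ hle).hom x = 0 := by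
      rw [Scheme.Hom.appLE, CommRingCat.hom_comp, RingHom.comp_apply, h3, map_zero]
    rw [h4, CommRingCat.hom_comp, RingHom.comp_apply] at h5
    have h6 : (Ideal.Quotient.mk J) x = 0 := by
      have := congr((Scheme.ΓSpecIso (.of (Γ(X, W.1) ⧸ J))).hom.hom $h5)
      simpa using this
    exact Ideal.Quotient.eq_zero_iff_mem.mp h6
  · rw [Ideal.map_le_iff_le_comap]
    intro x hx
    have h1 := Scheme.Hom.ideal_ker_le _ V (I.le_map_comap f V hx)
    rw [RingHom.mem_ker] at h1
    rw [Ideal.mem_comap, ← Scheme.IdealSheafData.ker_subschemeι_app, RingHom.mem_ker]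
    have h2 : f.appLE V.1 W.1 h ≫ (I.comap f).subschemeι.app W.1 =
        ((I.comap f).subschemeι ≫ f).app V.1 ≫ (I.comap f).subscheme.presheaf.map
          (homOfLE ((I.comap f).subschemeι.preimage_mono h)).op := by
      rw [Scheme.Hom.app_eq_appLE, Scheme.Hom.app_eq_appLE, Scheme.Hom.appLE_comp_appLE]
      exact (Scheme.Hom.appLE_map _ _ _).symm
    have h3 := congr($(h2).hom x)
    rw [CommRingCat.hom_comp, CommRingCat.hom_comp, RingHom.comp_apply, RingHom.comp_apply, h1,
      map_zero] at h3
    exact h3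

lemma exists_affineOpens_le_preimage {X Y : Scheme.{u}} (f : X ⟶ Y) (V : Y.affineOpens)
    (O : X.Opens) (x : X) (hxO : x ∈ O) (hx : f x ∈ V.1) :
    ∃ W : X.affineOpens, x ∈ W.1 ∧ W.1 ≤ f ⁻¹ᵁ V.1 ∧ W.1 ≤ O := by
  obtain ⟨W, hW, hxW, hWO⟩ := Opens.isBasis_iff_nbhd.mp X.isBasis_affineOpens
    (U := f ⁻¹ᵁ V.1 ⊓ O) ⟨hx, hxO⟩
  exact ⟨⟨W, hW⟩, hxW, hWO.trans inf_le_left, hWO.trans inf_le_right⟩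

lemma exists_affineOpens_mem {X : Scheme.{u}} (x : X) : ∃ V : X.affineOpens, x ∈ V.1 := by
  obtain ⟨W, hW, hxW, -⟩ := Opens.isBasis_iff_nbhd.mp X.isBasis_affineOpens
    (U := ⊤) (x := x) trivial
  exact ⟨⟨W, hW⟩, hxW⟩

lemma comap_pow {X Y : Scheme.{u}} (I : Y.IdealSheafData) (f : X ⟶ Y) (n : ℕ) :
    (I ^ n).comap f = I.comap f ^ n := by
  have h : ∀ x : X, ∃ W : X.affineOpens, x ∈ W.1 ∧ ∃ V : Y.affineOpens, W.1 ≤ f ⁻¹ᵁ V.1 := by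
    intro x
    obtain ⟨V, hV⟩ := exists_affineOpens_mem (f x)
    obtain ⟨W, h1, h2, -⟩ := exists_affineOpens_le_preimage f V ⊤ x trivial hV
    exact ⟨W, h1, V, h2⟩
  choose W hW V hV using h
  refine Scheme.IdealSheafData.ext_of_iSup_eq_top W
    (top_le_iff.mp fun x _ => Opens.mem_iSup.mpr ⟨x, hW x⟩) fun x => ?_
  rw [ideal_comap_of_le _ f (V x) (W x) (hV x), Scheme.IdealSheafData.ideal_pow,
    Scheme.IdealSheafData.ideal_pow, Pi.pow_apply, Pi.pow_apply,
    ideal_comap_of_le _ f (V x) (W x) (hV x), Ideal.map_pow]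

/-- Two affine neighbourhoods contain a common smaller one, so all ideals in the supremum are equal.
-/
lemma stalkIdeal_eq_map {X : Scheme.{u}} (I : X.IdealSheafData) (x : X) (V : X.affineOpens)
    (hx : x ∈ V.1) : stalkIdeal I x = (I.ideal V).map (X.presheaf.germ V.1 x hx).hom := by
  refine le_antisymm (iSup₂_le fun V' hx' => ?_) (le_iSup₂_of_le V hx le_rfl)
  obtain ⟨W, hxW, hWV, hWV'⟩ := exists_affineOpens_le_preimage (𝟙 X) V V'.1 x hx' hx
  have h1 : ∀ (V₀ : X.affineOpens) (h : x ∈ V₀.1) (hle : W.1 ≤ V₀.1),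
      (I.ideal V₀).map (X.presheaf.germ V₀.1 x h).hom =
        (I.ideal W).map (X.presheaf.germ W.1 x hxW).hom := by
    intro V₀ h hle
    rw [← I.map_ideal' (homOfLE hle).op, Ideal.map_map, ← CommRingCat.hom_comp,
      X.presheaf.germ_res]
  rw [h1 V' hx' hWV', h1 V hx hWV]

lemma stalkIdeal_comap {X Y : Scheme.{u}} (I : Y.IdealSheafData) (f : X ⟶ Y) (x : X) :
    stalkIdeal (I.comap f) x = (stalkIdeal I (f x)).map (f.stalkMap x).hom := by
  obtain ⟨V, hV⟩ := exists_affineOpens_mem (f x)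
  obtain ⟨W, h1, h2, -⟩ := exists_affineOpens_le_preimage f V ⊤ x trivial hV
  rw [stalkIdeal_eq_map _ x W h1, ideal_comap_of_le I f V W h2, stalkIdeal_eq_map I _ V hV,
    Ideal.map_map, Ideal.map_map, ← CommRingCat.hom_comp, ← CommRingCat.hom_comp,
    Scheme.Hom.germ_stalkMap, Scheme.Hom.appLE, Category.assoc, X.presheaf.germ_res]

/-! ### Supports, locally principal ideal sheaves and effective Cartier divisors -/

lemma le_radical_of_support_le {X : Scheme.{u}} {I J : X.IdealSheafData}
    (h : J.support ≤ I.support) : I ≤ J.radical := by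
  rw [← Scheme.IdealSheafData.vanishingIdeal_support,
    ← Scheme.IdealSheafData.le_support_iff_le_vanishingIdeal]
  exact h

/-- `I` is locally generated by one section. -/
def IsLocallyPrincipal {X : Scheme.{u}} (I : X.IdealSheafData) : Prop :=
  ∀ x : X, ∃ V : X.affineOpens, x ∈ V.1 ∧ ∃ g, I.ideal V = Ideal.span {g}

lemma IsEffectiveCartier.isLocallyPrincipal {X : Scheme.{u}} {I : X.IdealSheafData}
    (h : IsEffectiveCartier I) : IsLocallyPrincipal I := fun x =>
  let ⟨V, hV, g, _, hg⟩ := h x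
  ⟨V, hV, g, hg⟩

/-- Pullback keeps the local generator but possibly not its regularity, which
`IsEffectiveCartier.of_isLocallyPrincipal` recovers from the support. -/
lemma IsLocallyPrincipal.comap {X Y : Scheme.{u}} {I : Y.IdealSheafData}
    (h : IsLocallyPrincipal I) (f : X ⟶ Y) : IsLocallyPrincipal (I.comap f) := fun x => by
  obtain ⟨V, hV, g, hg⟩ := h (f x)
  obtain ⟨W, h1, h2, -⟩ := exists_affineOpens_le_preimage f V ⊤ x trivial hV
  refine ⟨W, h1, f.appLE V.1 W.1 h2 g, ?_⟩
  rw [ideal_comap_of_le I f V W h2, hg, Ideal.map_span, Set.image_singleton]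

/-- On a quasi-compact scheme, a locally principal ideal sheaf whose zero set contains that of `J`
has a power contained in `J`. -/
lemma IsLocallyPrincipal.exists_pow_le {X : Scheme.{u}} [CompactSpace X] {I J : X.IdealSheafData}
    (hI : IsLocallyPrincipal I) (h : J.support ≤ I.support) : ∃ n : ℕ, I ^ n ≤ J := by
  choose V hV g hg using hI
  have h1 : ∀ x, ∃ n : ℕ, g x ^ n ∈ J.ideal (V x) := fun x =>
    le_radical_of_support_le h (V x) (by rw [hg]; exact Ideal.mem_span_singleton_self _)
  choose n hn using h1
  obtain ⟨t, ht⟩ := isCompact_univ.elim_finite_subcover (fun x => ((V x).1 : Set X))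
    (fun x => (V x).1.isOpen) fun x _ => Set.mem_iUnion.mpr ⟨x, hV x⟩
  -- The largest of the local exponents over a finite subcover.
  refine ⟨t.sup n, Scheme.IdealSheafData.le_of_iSup_eq_top (fun x : t => V x) ?_ ?_⟩
  · refine top_le_iff.mp fun x _ => ?_
    obtain ⟨y, hy, hxy⟩ := Set.mem_iUnion₂.mp (ht (Set.mem_univ x))
    exact Opens.mem_iSup.mpr ⟨⟨y, hy⟩, hxy⟩
  · rintro ⟨x, hx⟩
    rw [Scheme.IdealSheafData.ideal_pow, Pi.pow_apply, hg, Ideal.span_singleton_pow,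
      Ideal.span_singleton_le_iff_mem]
    exact Ideal.pow_mem_of_pow_mem _ (hn x) (Finset.le_sup (f := n) hx)

/-- Flat base change keeps multiplication by `g` injective. The case `f = 𝟙 X` gives restriction to
a smaller affine open. -/
lemma appLE_mem_nonZeroDivisors {X Y : Scheme.{u}} (f : X ⟶ Y) [Flat f] {V : Y.affineOpens}
    {W : X.affineOpens} (h : W.1 ≤ f ⁻¹ᵁ V.1) {g : Γ(Y, V.1)} (hg : g ∈ nonZeroDivisors Γ(Y, V.1)) :
    f.appLE V.1 W.1 h g ∈ nonZeroDivisors Γ(X, W.1) := by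
  have hf : (f.appLE V.1 W.1 h).hom.Flat := HasRingHomProperty.appLE @Flat f inferInstance V W h
  algebraize [(f.appLE V.1 W.1 h).hom]
  have h1 : IsSMulRegular Γ(X, W.1) g := Module.Flat.isSMulRegular_of_nonZeroDivisors hg
  refine mem_nonZeroDivisors_iff_left.mpr fun x hx => h1 ?_
  simpa [Algebra.smul_def, RingHom.algebraMap_toAlgebra] using! hx

lemma map_mem_nonZeroDivisors_of_le {X : Scheme.{u}} {V W : X.affineOpens} (h : W.1 ≤ V.1)
    {g : Γ(X, V.1)} (hg : g ∈ nonZeroDivisors Γ(X, V.1)) :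
    X.presheaf.map (homOfLE h).op g ∈ nonZeroDivisors Γ(X, W.1) := by
  have := appLE_mem_nonZeroDivisors (𝟙 X) (V := V) (W := W) h hg
  have h1 : (𝟙 X : X ⟶ X).appLE V.1 W.1 h = X.presheaf.map (homOfLE h).op := by
    simp only [Scheme.Hom.appLE, Scheme.Hom.id_app]
    exact Category.id_comp _
  rwa [h1] at this

lemma IsEffectiveCartier.exists_le {X : Scheme.{u}} {I : X.IdealSheafData}
    (h : IsEffectiveCartier I) (x : X) (O : X.Opens) (hx : x ∈ O) :
    ∃ V : X.affineOpens, x ∈ V.1 ∧ V.1 ≤ O ∧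
      ∃ g ∈ nonZeroDivisors Γ(X, V.1), I.ideal V = Ideal.span {g} := by
  obtain ⟨V, hV, g, hg, hI⟩ := h x
  obtain ⟨W, h1, h2, h3⟩ := exists_affineOpens_le_preimage (𝟙 X) V O x hx hV
  have hle : W.1 ≤ V.1 := h2
  refine ⟨W, h1, h3, _, map_mem_nonZeroDivisors_of_le hle hg, ?_⟩
  rw [← I.map_ideal' (homOfLE hle).op, hI, Ideal.map_span, Set.image_singleton]

/-- The local generator of `J` divides a power of the regular generator of `I`, so it is itself
regular. -/
lemma IsEffectiveCartier.of_isLocallyPrincipal {X : Scheme.{u}} {I J : X.IdealSheafData}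
    (hI : IsEffectiveCartier I) (hJ : IsLocallyPrincipal J) (h : J.support ≤ I.support) :
    IsEffectiveCartier J := fun x => by
  obtain ⟨V, hV, g, hg⟩ := hJ x
  obtain ⟨W, h1, h2, a, ha, haI⟩ := hI.exists_le x V.1 hV
  have hle : W.1 ≤ V.1 := h2
  have hJW : J.ideal W = Ideal.span {X.presheaf.map (homOfLE hle).op g} := by
    rw [← J.map_ideal' (homOfLE hle).op, hg, Ideal.map_span, Set.image_singleton]
  refine ⟨W, h1, _, ?_, hJW⟩
  obtain ⟨n, hn⟩ := le_radical_of_support_le h W (haI ▸ Ideal.mem_span_singleton_self a)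
  rw [hJW, Ideal.mem_span_singleton] at hn
  obtain ⟨b, hb⟩ := hn
  have := pow_mem ha n
  rw [hb] at this
  exact (mul_mem_nonZeroDivisors.mp this).1

lemma IsEffectiveCartier.mul {X : Scheme.{u}} {I J : X.IdealSheafData}
    (hI : IsEffectiveCartier I) (hJ : IsEffectiveCartier J) : IsEffectiveCartier (I * J) :=
  fun x => by
  obtain ⟨V, hV, g, hg, hgI⟩ := hI x
  obtain ⟨W, h1, h2, a, ha, haJ⟩ := hJ.exists_le x V.1 hV
  have hle : W.1 ≤ V.1 := h2
  refine ⟨W, h1, _, mul_mem (map_mem_nonZeroDivisors_of_le hle hg) ha, ?_⟩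
  rw [Scheme.IdealSheafData.ideal_mul, Pi.mul_apply, haJ, ← I.map_ideal' (homOfLE hle).op, hgI, Ideal.map_span,
    Set.image_singleton, Ideal.span_singleton_mul_span_singleton]

lemma isEffectiveCartier_top (X : Scheme.{u}) : IsEffectiveCartier (⊤ : X.IdealSheafData) :=
  fun x => by
  obtain ⟨V, hV⟩ := exists_affineOpens_mem x
  exact ⟨V, hV, 1, one_mem _, by simp [Scheme.IdealSheafData.ideal_top]⟩

lemma IsEffectiveCartier.pow {X : Scheme.{u}} {I : X.IdealSheafData}
    (hI : IsEffectiveCartier I) (n : ℕ) : IsEffectiveCartier (I ^ n) := by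
  induction n with
  | zero => rw [pow_zero]; exact isEffectiveCartier_top X
  | succ n ih => rw [pow_succ]; exact ih.mul hI

/-- The complement of an effective Cartier divisor is dense. -/
lemma IsEffectiveCartier.dense_compl_support {X : Scheme.{u}} {I : X.IdealSheafData}
    (hI : IsEffectiveCartier I) : Dense ((I.support : Set X)ᶜ) := by
  rw [dense_iff_inter_open]
  intro O hO ⟨x, hx⟩
  by_contra hne
  have hsub : O ⊆ I.support := fun y hy => by
    by_contra h
    exact hne ⟨y, hy, h⟩
  obtain ⟨V, hV, hVO, g, hg, hgI⟩ := hI.exists_le x ⟨O, hO⟩ hx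
  -- If the support contained `V`, then `g` would vanish at every point of `V` and be nilpotent. A
  -- nilpotent nonzerodivisor forces the zero ring, but `V` contains `x`.
  have h1 : X.basicOpen g = ⊥ := by
    refine bot_unique fun y hy => ?_
    have hyV : y ∈ V.1 := X.basicOpen_le g hy
    have h2 := (Scheme.IdealSheafData.mem_support_iff_of_mem hyV).mp (hsub (hVO hyV))
    rw [Scheme.mem_zeroLocus_iff] at h2
    exact h2 g (by rw [hgI]; exact Ideal.mem_span_singleton_self g) hy
  obtain ⟨n, hn⟩ := (Scheme.isNilpotent_iff_basicOpen_eq_bot_of_isCompact (IsAffineOpen.isCompact V.2) g).mpr h1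
  have h3 := pow_mem hg n
  rw [hn] at h3
  have : Subsingleton Γ(X, V.1) := ⟨fun a b => by
    have h4 : ∀ c : Γ(X, V.1), c = 0 := fun c =>
      (mem_nonZeroDivisors_iff.mp h3).1 c (by simp)
    rw [h4 a, h4 b]⟩
  have h5 : x ∈ X.basicOpen (0 : Γ(X, V.1)) := by
    rw [Subsingleton.elim (0 : Γ(X, V.1)) 1]
    simpa using hV
  simp at h5

/-! ### Local rings of the normalization of a scheme in a field -/

lemma range_isIntegrallyClosed_of_integralClosure {A T B T' : Type*} [CommRing A] [CommRing T]
    [CommRing B] [CommRing T'] [Algebra A T] (e : B ≃+* integralClosure A T) (c : T ≃+* T')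
    (h : B →+* T') (hh : ∀ b, h b = c (e b)) :
    Function.Injective h ∧ ∀ x, h.IsIntegralElem x → x ∈ h.range := by
  refine ⟨fun a b hab => ?_, fun x hx => ?_⟩
  · rw [hh, hh] at hab
    exact e.injective (Subtype.val_injective (c.injective hab))
  · have h1 : IsIntegral (integralClosure A T) (c.symm x) := by
      obtain ⟨p, hp, hpx⟩ := hx
      refine ⟨p.map e.toRingHom, hp.map _, ?_⟩
      rw [Polynomial.eval₂_map]
      apply c.injective
      rw [map_zero, ← RingEquiv.coe_toRingHom c, Polynomial.hom_eval₂]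
      have h2 : c.toRingHom.comp ((algebraMap (integralClosure A T) T).comp e.toRingHom) = h :=
        RingHom.ext fun b => (hh b).symm
      have h3 : c.toRingHom (c.symm x) = x := c.apply_symm_apply x
      exact (congrArg₂ (fun a b => Polynomial.eval₂ a b p) h2 h3).trans hpx
    have h2 : IsIntegral A (c.symm x) := isIntegral_trans (A := integralClosure A T) _ h1
    refine ⟨e.symm ⟨c.symm x, h2⟩, ?_⟩
    rw [hh, RingEquiv.apply_symm_apply]
    exact c.apply_symm_apply x

/-- An element integral over the localization becomes integral over `A` after multiplication by some
`m` in `M`. -/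
lemma range_isIntegrallyClosed_of_isLocalization {A R K : Type*} [CommRing A] [CommRing R]
    [CommRing K]
    [Algebra A R] [Algebra A K] [Algebra R K] [IsScalarTower A R K] (M : Submonoid A)
    [IsLocalization M R] (hinj : Function.Injective (algebraMap A K))
    (hA : ∀ x : K, IsIntegral A x → x ∈ (algebraMap A K).range) :
    Function.Injective (algebraMap R K) ∧
      ∀ x : K, IsIntegral R x → x ∈ (algebraMap R K).range := by
  refine ⟨?_, fun x hx => ?_⟩
  · rw [injective_iff_map_eq_zero]
    intro r hr
    obtain ⟨a, s, rfl⟩ := IsLocalization.exists_mk'_eq M r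
    have h1 := congrArg (algebraMap R K) (IsLocalization.mk'_spec R a s)
    rw [map_mul, hr, zero_mul, ← IsScalarTower.algebraMap_apply] at h1
    rw [hinj (h1.symm.trans (map_zero _).symm), IsLocalization.mk'_zero]
  · obtain ⟨m, hm⟩ := hx.exists_multiple_integral_of_isLocalization M x
    obtain ⟨b, hb⟩ := hA _ hm
    refine ⟨IsLocalization.mk' R b m, ?_⟩
    have h1 := congrArg (algebraMap R K) (IsLocalization.mk'_spec R b m)
    rw [map_mul, ← IsScalarTower.algebraMap_apply, ← IsScalarTower.algebraMap_apply, hb,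
      Submonoid.smul_def, Algebra.smul_def, mul_comm] at h1
    have h2 : IsUnit (algebraMap A K m) := by
      rw [IsScalarTower.algebraMap_apply A R K]
      exact (IsLocalization.map_units R m).map _
    exact h2.mul_left_cancel h1

/-- Over an affine open `V`, the normalization is the spectrum of the integral closure of `Γ(Y, V)`
in `Γ(S, f ⁻¹ᵁ V)`. -/
lemma toNormalization_app_range_isIntegrallyClosed {S Y : Scheme.{u}} (f : S ⟶ Y) [QuasiCompact f]
    [QuasiSeparated f] (V : Y.affineOpens) :
    Function.Injective (f.toNormalization.app (f.fromNormalization ⁻¹ᵁ V.1)).hom ∧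
      ∀ x, (f.toNormalization.app (f.fromNormalization ⁻¹ᵁ V.1)).hom.IsIntegralElem x →
        x ∈ (f.toNormalization.app (f.fromNormalization ⁻¹ᵁ V.1)).hom.range := by
  let := (f.app V.1).hom.toAlgebra
  have h := f.toNormalization_app_preimage V
  refine range_isIntegrallyClosed_of_integralClosure (A := Γ(Y, V.1)) (T := Γ(S, f ⁻¹ᵁ V.1))
    (f.normalizationObjIso V.2).commRingCatIsoToRingEquiv
    (asIso (S.presheaf.map (eqToHom (by simp [← Scheme.Hom.comp_preimage])).op)).commRingCatIsoToRingEquiv _ fun b => ?_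
  rw [h]
  rfl

/-- The function field of an integral scheme of dimension at most one and locally of finite type
over `k` has transcendence degree at most one over `k`. -/
lemma trdeg_functionField_le_one {k : Type u} [Field k] (Z : Scheme.{u}) [IsIntegral Z]
    (t : Z ⟶ Spec (.of k)) [LocallyOfFiniteType t] (hd : topologicalKrullDim Z ≤ 1)
    (φ : CommRingCat.of k ⟶ Z.functionField)
    (h : Z.fromSpecStalk (genericPoint Z) ≫ t = Spec.map φ) :
    @Algebra.trdeg k Z.functionField _ _ φ.hom.toAlgebra ≤ 1 := by
  obtain ⟨W, hW⟩ := exists_affineOpens_mem (genericPoint Z)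
  have hWa : IsAffineOpen W.1 := W.2
  have : Nonempty W.1 := ⟨⟨_, hW⟩⟩
  have hT : IsAffineOpen (⊤ : (Spec (.of k)).Opens) := isAffineOpen_top _
  let a : CommRingCat.of k ⟶ Γ(Z, W.1) :=
    (Scheme.ΓSpecIso (.of k)).inv ≫ t.appLE ⊤ W.1 le_top
  have ha : a.hom.FiniteType := by
    have h1 := t.finiteType_appLE hT hWa le_top
    rw [CommRingCat.hom_comp]
    exact h1.comp (.of_surjective _ (ConcreteCategory.bijective_of_isIso
      (Scheme.ΓSpecIso (.of k)).inv).surjective)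
  have hsp : hWa.fromSpec ≫ t = Spec.map a := by
    rw [← IsAffineOpen.SpecMap_appLE_fromSpec t hT hWa le_top, Spec.map_comp,
      IsAffineOpen.fromSpec_top]
    simp
  let := φ.hom.toAlgebra
  algebraize [a.hom]
  have : IsScalarTower k Γ(Z, W.1) Z.functionField := by
    refine .of_algebraMap_eq' ?_
    have h1 : φ = a ≫ Z.presheaf.germ W.1 (genericPoint Z) hW := by
      apply Spec.map_injective
      rw [← h, Spec.map_comp, ← hsp, ← hWa.fromSpecStalk_eq_fromSpecStalk hW]
      rfl
    exact congr(($h1).hom)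
  have : IsFractionRing Γ(Z, W.1) Z.functionField :=
    functionField_isFractionRing_of_isAffineOpen Z W.1 hWa
  refine trdeg_le_one_of_ringKrullDim_le_one (A := Γ(Z, W.1)) ?_
  rw [← PrimeSpectrum.topologicalKrullDim_eq_ringKrullDim]
  exact (hWa.fromSpec.isOpenEmbedding.isInducing.topologicalKrullDim_le).trans hd

namespace NormalCompactification

variable {k : Type u} [Field k] {U : Scheme.{u}} {s : U ⟶ Spec (.of k)}
variable (X : NormalCompactification s) (C : IntegralCurve U)

/-- `stalkToFunctionField` as a morphism of the category of commutative rings. -/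
def stalkHom (y : X.curveNormalization C) :
    (X.curveNormalization C).presheaf.stalk y ⟶ C.Z.functionField :=
  (X.curveNormalization C).presheaf.stalkSpecializes (X.generic_specializes C y) ≫
    Scheme.stalkClosedPointTo (X.generic C)

lemma SpecMap_stalkHom_fromSpecStalk (y : X.curveNormalization C) :
    Spec.map (X.stalkHom C y) ≫ (X.curveNormalization C).fromSpecStalk y = X.generic C := by
  rw [stalkHom, Spec.map_comp, Category.assoc, Scheme.SpecMap_stalkSpecializes_fromSpecStalk,
    Scheme.Spec_stalkClosedPointTo_fromSpecStalk]

lemma generic_psi : X.generic C ≫ X.psi C = X.fromSpecFunctionField C :=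
  (X.fromSpecFunctionField C).toNormalization_fromNormalization

instance : IsIntegralHom (X.psi C) :=
  inferInstanceAs (IsIntegralHom (X.fromSpecFunctionField C).fromNormalization)

/-- The generic point lies in `N`, so the preimage of `N` in `Spec k(Z)` is everything and `c`
identifies its sections with `k(Z)`. -/
lemma germ_stalkHom (y : X.curveNormalization C) (N : (X.curveNormalization C).Opens)
    (hy : y ∈ N) :
    ∃ c : Γ(Spec C.Z.functionField, X.generic C ⁻¹ᵁ N) ≅ C.Z.functionField,
      (X.curveNormalization C).presheaf.germ N y hy ≫ X.stalkHom C y =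
        (X.generic C).app N ≫ c.hom := by
  have hg : X.generic C (IsLocalRing.closedPoint C.Z.functionField) ∈ N :=
    (X.generic_specializes C y).mem_open N.isOpen hy
  refine ⟨_, Eq.trans ?_ (Scheme.germ_stalkClosedPointTo (X.generic C) N hg)⟩
  rw [stalkHom, TopCat.Presheaf.germ_stalkSpecializes_assoc]

/-- The sections over the preimage of an affine open of `X` are integrally closed in `k(Z)`, and the
stalk is a localization of them. -/
lemma stalkHom_range_isIntegrallyClosed (y : X.curveNormalization C) :
    Function.Injective (X.stalkHom C y).hom ∧
      ∀ x, (X.stalkHom C y).hom.IsIntegralElem x → x ∈ (X.stalkHom C y).hom.range := by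
  obtain ⟨V, hV⟩ := exists_affineOpens_mem (X.psi C y)
  set N := X.psi C ⁻¹ᵁ V.1 with hN
  have hNa : IsAffineOpen N := IsAffineOpen.preimage V.2 (X.psi C)
  have hy : y ∈ N := hV
  obtain ⟨c, hc⟩ := X.germ_stalkHom C y N hy
  obtain ⟨h2, h3⟩ := toNormalization_app_range_isIntegrallyClosed (X.fromSpecFunctionField C) V
  let := ((X.curveNormalization C).presheaf.germ N y hy ≫ X.stalkHom C y).hom.toAlgebra
  let := (X.stalkHom C y).hom.toAlgebra
  let := (X.curveNormalization C).presheaf.algebra_section_stalk ⟨y, hy⟩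
  have : IsScalarTower Γ(X.curveNormalization C, N) ((X.curveNormalization C).presheaf.stalk y)
      C.Z.functionField := .of_algebraMap_eq' rfl
  have hloc : IsLocalization.AtPrime ((X.curveNormalization C).presheaf.stalk y)
    (hNa.primeIdealOf ⟨y, hy⟩).asIdeal := hNa.isLocalization_stalk ⟨y, hy⟩
  refine range_isIntegrallyClosed_of_isLocalization (hNa.primeIdealOf ⟨y, hy⟩).asIdeal.primeCompl
    (R := (X.curveNormalization C).presheaf.stalk y) (A := Γ(X.curveNormalization C, N)) ?_ ?_
  · change Function.Injective ((X.curveNormalization C).presheaf.germ N y hy ≫ X.stalkHom C y).hom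
    rw [hc]
    exact c.commRingCatIsoToRingEquiv.injective.comp h2
  · intro x hx
    obtain ⟨p, hp, hpx⟩ := hx
    obtain ⟨b, hb⟩ := h3 (c.inv.hom x) ⟨p, hp, by
      apply c.commRingCatIsoToRingEquiv.injective
      refine (Polynomial.hom_eval₂ p _ c.hom.hom _).trans (Eq.trans ?_ (map_zero _).symm)
      refine Eq.trans ?_ hpx
      exact congrArg₂ (fun a b => Polynomial.eval₂ a b p) congr(($hc).hom).symm
        (c.commRingCatIsoToRingEquiv.apply_symm_apply x)⟩
    refine ⟨b, ?_⟩
    refine (congr(($hc).hom b)).trans ?_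
    refine (congrArg c.hom.hom hb).trans ?_
    exact c.commRingCatIsoToRingEquiv.apply_symm_apply x

/-- If the stalk were a field, `y` would be the generic point of `Z^N`, which lies over `U`. -/
lemma not_isField_stalk {y : X.curveNormalization C} (hy : y ∈ X.pointsAtInfinity C) :
    ¬ IsField ((X.curveNormalization C).presheaf.stalk y) := by
  intro hf
  apply hy
  have h1 : X.generic C (IsLocalRing.closedPoint C.Z.functionField) ∈
      Set.range ((X.curveNormalization C).fromSpecStalk y) := by
    rw [Scheme.range_fromSpecStalk]
    exact X.generic_specializes C y
  obtain ⟨p, hp⟩ := h1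
  let := hf.toField
  have hs : Subsingleton (PrimeSpectrum ((X.curveNormalization C).presheaf.stalk y)) := by
    infer_instance
  have h2 : p = IsLocalRing.closedPoint _ := hs.elim _ _
  rw [h2, Scheme.fromSpecStalk_closedPoint] at hp
  have h3 : X.generic C ≫ X.psi C =
      (C.Z.fromSpecStalk (genericPoint C.Z) ≫ C.incl) ≫ X.incl := by
    rw [generic_psi, fromSpecFunctionField, Category.assoc]
  rw [hp]
  exact ⟨_, congr($(h3.symm) (IsLocalRing.closedPoint C.Z.functionField))⟩

lemma isDomain_stalk_curveNormalization (y : X.curveNormalization C) :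
    IsDomain ((X.curveNormalization C).presheaf.stalk y) :=
  (X.stalkHom_range_isIntegrallyClosed C y).1.isDomain (X.stalkHom C y).hom

/-- The local ring of `Z^N` at a point at infinity is a valuation ring with fraction field
`k(Z)`. -/
lemma valuationRing_stalk [LocallyOfFiniteType s] {y : X.curveNormalization C}
    (hy : y ∈ X.pointsAtInfinity C) :
    haveI := X.isDomain_stalk_curveNormalization C y
    ValuationRing ((X.curveNormalization C).presheaf.stalk y) ∧
      @IsFractionRing ((X.curveNormalization C).presheaf.stalk y) _ C.Z.functionField _
        (X.stalkHom C y).hom.toAlgebra := by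
  obtain ⟨h1, h2⟩ := X.stalkHom_range_isIntegrallyClosed C y
  have := X.isDomain_stalk_curveNormalization C y
  -- The `k`-algebra structure of the stalk; composed with `stalkHom` it gives the usual one on
  -- `k(Z)`.
  let φ : CommRingCat.of k ⟶ (X.curveNormalization C).presheaf.stalk y :=
    Spec.preimage ((X.curveNormalization C).fromSpecStalk y ≫ X.psi C ≫ X.str)
  refine valuationRing_and_isFractionRing_of_trdeg_le_one (Field.toIsField C.Z.functionField)
    φ.hom (X.stalkHom C y).hom h2 h1 (X.not_isField_stalk C hy) ?_
  refine trdeg_functionField_le_one C.Z (C.incl ≫ s) C.dim_eq_one.le (φ ≫ X.stalkHom C y) ?_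
  rw [Spec.map_comp, Spec.map_preimage, ← Category.assoc (Spec.map _),
    SpecMap_stalkHom_fromSpecStalk, ← Category.assoc (X.generic C), generic_psi,
    fromSpecFunctionField, Category.assoc, Category.assoc, X.incl_comp_str]

end NormalCompactification

/-! ### Comparison of congruence subgroups -/

open IsLocalRing in
/-- The ideal of the local ring `R` generated by the ideal sheaf `I` along `φ : Spec R ⟶ Y`. -/
def closedIdeal {Y : Scheme.{u}} {R : CommRingCat.{u}} [IsLocalRing R] (I : Y.IdealSheafData)
    (φ : Spec R ⟶ Y) : Ideal R :=
  (stalkIdeal I (φ (closedPoint R))).map (Scheme.stalkClosedPointTo φ).hom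

lemma closedIdeal_mono {Y : Scheme.{u}} {R : CommRingCat.{u}} [IsLocalRing R]
    {I J : Y.IdealSheafData} (h : I ≤ J) (φ : Spec R ⟶ Y) : closedIdeal I φ ≤ closedIdeal J φ :=
  Ideal.map_mono (stalkIdeal_mono h _)

lemma closedIdeal_comp {X Y : Scheme.{u}} {R : CommRingCat.{u}} [IsLocalRing R]
    (I : Y.IdealSheafData) (φ : Spec R ⟶ X) (f : X ⟶ Y) :
    closedIdeal I (φ ≫ f) = closedIdeal (I.comap f) φ := by
  rw [closedIdeal, closedIdeal, stalkIdeal_comap, Ideal.map_map, ← CommRingCat.hom_comp,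
    Scheme.stalkClosedPointTo_comp]
  rfl

lemma closedIdeal_fromSpecStalk {Y : Scheme.{u}} (I : Y.IdealSheafData) (y : Y) :
    closedIdeal I (Y.fromSpecStalk y) = stalkIdeal I y := by
  have h : Y.fromSpecStalk y = Spec.map (𝟙 (Y.presheaf.stalk y)) ≫ Y.fromSpecStalk y := by simp
  obtain ⟨V, hV⟩ := exists_affineOpens_mem y
  rw [h, closedIdeal, stalkIdeal_eq_map I y V hV, stalkIdeal_eq_map I _ V (by
    rw [← h, Scheme.fromSpecStalk_closedPoint]; exact hV), Ideal.map_map,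
    ← CommRingCat.hom_comp, Scheme.germ_stalkClosedPointTo_Spec_fromSpecStalk]
  simp

lemma exists_lift_of_valuationRing {R K : CommRingCat.{u}} [IsDomain R] [ValuationRing R]
    (hK : IsField K) (σ : R ⟶ K) (hσ : @IsFractionRing R _ K _ σ.hom.toAlgebra) {T S : Scheme.{u}}
    (t : T ⟶ S) [UniversallyClosed t] (i₁ : Spec K ⟶ T) (i₂ : Spec R ⟶ S)
    (h : i₁ ≫ t = Spec.map σ ≫ i₂) : ∃ l : Spec R ⟶ T, Spec.map σ ≫ l = i₁ ∧ l ≫ t = i₂ := by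
  let := hK.toField
  let := σ.hom.toAlgebra
  have h1 : ValuativeCriterion.Existence t := by
    have h2 : UniversallyClosed t := inferInstance
    rw [UniversallyClosed.eq_valuativeCriterion] at h2
    exact h2.1
  obtain ⟨⟨l, hl₁, hl₂⟩⟩ := h1 { R := R, K := K, i₁ := i₁, i₂ := i₂, commSq := ⟨h⟩ }
  exact ⟨l, hl₁, hl₂⟩

/-- `Spec K ⟶ Spec R` is dominant, `Spec R` is reduced, and `t` is separated. -/
lemma eq_of_SpecMap_comp_eq {R K : CommRingCat.{u}} [IsDomain R] (σ : R ⟶ K)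
    (hσ : Function.Injective σ.hom) {T S : Scheme.{u}} (t : T ⟶ S) [IsSeparated t]
    {a b : Spec R ⟶ T} (h : a ≫ t = b ≫ t) (h' : Spec.map σ ≫ a = Spec.map σ ≫ b) : a = b := by
  have : IsDominant (Spec.map σ) := by
    refine ⟨(PrimeSpectrum.denseRange_comap_iff_ker_le_nilRadical σ.hom).mpr ?_⟩
    rw [(RingHom.injective_iff_ker_eq_bot _).mp hσ]
    exact bot_le
  exact ext_of_isDominant_of_isSeparated t h (Spec.map σ) h'

namespace NormalCompactification

variable {k : Type u} [Field k] {U : Scheme.{u}} {s : U ⟶ Spec (.of k)}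

lemma idealAt_eq (X : NormalCompactification s) (C : IntegralCurve U) (I : X.X.IdealSheafData)
    (y : X.curveNormalization C) : X.idealAt C I y = stalkIdeal (I.comap (X.psi C)) y :=
  (stalkIdeal_comap I (X.psi C) y).symm

open IsLocalRing in
/-- If `T` is a proper model that dominates `X₁` and `X₂` and `I₂ 𝒪_T ⊆ I₁ 𝒪_T`, then the
congruence subgroup of `I₂` is contained in that of `I₁`. -/
lemma congruenceSubgroup_le_of_comap_le [LocallyOfFiniteType s] {X₁ X₂ : NormalCompactification s}
    {T : Scheme.{u}} (j : U ⟶ T) (p₁ : T ⟶ X₁.X) (p₂ : T ⟶ X₂.X)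
    [UniversallyClosed (p₁ ≫ X₁.str)] (hj₁ : j ≫ p₁ = X₁.incl) (hj₂ : j ≫ p₂ = X₂.incl)
    (hp : ∀ t, p₂ t ∈ Set.range X₂.incl → p₁ t ∈ Set.range X₁.incl)
    {I₁ : X₁.X.IdealSheafData} {I₂ : X₂.X.IdealSheafData} (hI : I₂.comap p₂ ≤ I₁.comap p₁)
    (C : IntegralCurve U) : X₂.congruenceSubgroup C I₂ ≤ X₁.congruenceSubgroup C I₁ := by
  intro g hg
  refine (Subgroup.mem_iInf.mpr fun y => Subgroup.mem_iInf.mpr fun hy => ?_)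
  have := X₁.isDomain_stalk_curveNormalization C y
  obtain ⟨hval, hfrac⟩ := X₁.valuationRing_stalk C hy
  have hinj := (X₁.stalkHom_range_isIntegrallyClosed C y).1
  have hK : IsField C.Z.functionField := Field.toIsField C.Z.functionField
  -- First lift: the valuation ring at `y` acquires a center on `T`, by the valuative criterion over
  -- `k`.
  obtain ⟨τ, hτ₁, hτ₂⟩ := exists_lift_of_valuationRing hK (X₁.stalkHom C y) hfrac
    (p₁ ≫ X₁.str) (C.Z.fromSpecStalk (genericPoint C.Z) ≫ C.incl ≫ j)
    ((X₁.curveNormalization C).fromSpecStalk y ≫ X₁.psi C ≫ X₁.str) (by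
      rw [← Category.assoc (Spec.map _), SpecMap_stalkHom_fromSpecStalk,
        ← Category.assoc (X₁.generic C), generic_psi, fromSpecFunctionField]
      simp only [Category.assoc, ← hj₁])
  have hτ : τ ≫ p₁ = (X₁.curveNormalization C).fromSpecStalk y ≫ X₁.psi C := by
    refine eq_of_SpecMap_comp_eq (X₁.stalkHom C y) hinj X₁.str (by simpa using hτ₂) ?_
    rw [← Category.assoc (Spec.map _), ← Category.assoc (Spec.map _),
      SpecMap_stalkHom_fromSpecStalk, generic_psi, fromSpecFunctionField, hτ₁, ← hj₁]
    simp only [Category.assoc]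
  -- Second lift: `psi` is integral, hence universally closed, so the center moves up to the
  -- normalized curve over `X₂`.
  obtain ⟨l, hl₁, hl₂⟩ := exists_lift_of_valuationRing hK (X₁.stalkHom C y) hfrac
    (X₂.psi C) (X₂.generic C) (τ ≫ p₂) (by
      rw [← Category.assoc (Spec.map _), hτ₁, generic_psi, fromSpecFunctionField, ← hj₂]
      simp only [Category.assoc])
  set c := closedPoint ((X₁.curveNormalization C).presheaf.stalk y) with hc
  have hy₂ : l c ∈ X₂.pointsAtInfinity C := by
    intro hmem
    refine hy ?_
    have h1 : X₂.psi C (l c) = p₂ (τ c) := congr($hl₂ c)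
    have h2 : p₁ (τ c) = X₁.psi C ((X₁.curveNormalization C).fromSpecStalk y c) := congr($hτ c)
    rw [Scheme.fromSpecStalk_closedPoint] at h2
    rw [← h2]
    exact hp _ (h1 ▸ hmem)
  obtain ⟨v, hv, rfl⟩ := Subgroup.mem_iInf.mp (Subgroup.mem_iInf.mp hg (l c)) hy₂
  -- The local map from the stalk at `l c` to the stalk at `y` respects the embeddings in `k(Z)`, so
  -- it carries the unit representing `g` to a unit representing `g`.
  have hcomp : Scheme.stalkClosedPointTo l ≫ X₁.stalkHom C y = X₂.stalkHom C (l c) := by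
    apply Spec.map_injective
    rw [← cancel_mono ((X₂.curveNormalization C).fromSpecStalk (l c)),
      SpecMap_stalkHom_fromSpecStalk, Spec.map_comp, Category.assoc,
      Scheme.Spec_stalkClosedPointTo_fromSpecStalk, hl₁]
  refine ⟨Units.map (Scheme.stalkClosedPointTo l).hom.toMonoidHom v, ?_, ?_⟩
  · have hv1 : Ideal.Quotient.mk (X₂.idealAt C I₂ (l c)) (v : _) = 1 :=
      congrArg Units.val (MonoidHom.mem_ker.mp hv)
    rw [← map_one (Ideal.Quotient.mk _), Ideal.Quotient.eq] at hv1
    refine MonoidHom.mem_ker.mpr (Units.ext ?_)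
    change Ideal.Quotient.mk (X₁.idealAt C I₁ y) ((Scheme.stalkClosedPointTo l).hom v) = 1
    rw [← map_one (Ideal.Quotient.mk _), Ideal.Quotient.eq,
      ← map_one (Scheme.stalkClosedPointTo l).hom, ← map_sub]
    -- Both ideals are pulled back from `T` along `τ`, where `hI` compares them.
    have h1 : closedIdeal (I₂.comap (X₂.psi C)) l ≤ X₁.idealAt C I₁ y := by
      have h0 : X₁.idealAt C I₁ y = closedIdeal (I₁.comap p₁) τ := by
        rw [idealAt_eq, ← closedIdeal_fromSpecStalk, ← closedIdeal_comp, ← hτ, closedIdeal_comp]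
      rw [← closedIdeal_comp, hl₂, closedIdeal_comp, h0]
      exact closedIdeal_mono hI τ
    refine h1 (Ideal.mem_map_of_mem _ ?_)
    rw [← idealAt_eq]
    exact hv1
  · refine Units.ext ?_
    exact congr(($hcomp).hom v)

end NormalCompactification

/-! ### Common models of two compactifications -/

/-- Over affine opens of `Y`, the sections of the scheme-theoretic image inject into sections of
`X`. -/
lemma isReduced_image {X Y : Scheme.{u}} (f : X ⟶ Y) [QuasiCompact f] [IsReduced X] :
    IsReduced f.image := by
  refine ⟨fun O => ⟨fun a ha => ?_⟩⟩
  apply TopCat.Presheaf.section_ext f.image.sheaf O a 0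
  intro x hx
  have hB := Y.isBasis_affineOpens.of_isInducing f.imageι.isEmbedding.isInducing
  obtain ⟨_, ⟨V, hV, rfl⟩, hxV, hVO⟩ := Opens.isBasis_iff_nbhd.mp hB hx
  have hVO' : f.imageι ⁻¹ᵁ V ≤ O := hVO
  have h : f.image.presheaf.map (homOfLE hVO').op a = 0 := by
    apply f.toImage_app_injective ⟨V, hV⟩
    rw [map_zero]
    exact ((ha.map (f.image.presheaf.map (homOfLE hVO').op).hom).map
      (f.toImage.app (f.imageι ⁻¹ᵁ V)).hom).eq_zero
  change f.image.presheaf.germ O x hx a = f.image.presheaf.germ O x hx 0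
  rw [map_zero, ← f.image.presheaf.germ_res (homOfLE hVO') x hxV, CommRingCat.comp_apply, h]
  exact map_zero _

namespace NormalCompactification

variable {k : Type u} [Field k] {U : Scheme.{u}} {s : U ⟶ Spec (.of k)}

instance (X : NormalCompactification s) : IsReduced X.X :=
  have (x : X.X) : _root_.IsReduced (X.X.presheaf.stalk x) :=
    have := X.isDomain_stalk x
    inferInstance
  isReduced_of_isReduced_stalk X.X

instance (X : NormalCompactification s) : IsDominant X.incl := by
  obtain ⟨I, hI, hsupp⟩ := X.boundary
  have h := hI.dense_compl_support
  rw [hsupp, compl_compl] at h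
  exact ⟨h⟩

instance (X : NormalCompactification s) : CompactSpace X.X :=
  QuasiCompact.compactSpace_of_compactSpace X.str

/-- On `V = p₁⁻¹(U)` the map `p₁` retracts `V` onto `U`. Followed by the inclusion in `X₂`, it
agrees with `p₂` on the dense subscheme `U`, hence on all of the reduced scheme `V`. -/
lemma mem_range_incl_of_mem_range_incl {X₁ X₂ : NormalCompactification s} {T : Scheme.{u}}
    [IsReduced T] (j : U ⟶ T) [IsDominant j] (p₁ : T ⟶ X₁.X) (p₂ : T ⟶ X₂.X)
    (hp : p₁ ≫ X₁.str = p₂ ≫ X₂.str) (hj₁ : j ≫ p₁ = X₁.incl) (hj₂ : j ≫ p₂ = X₂.incl)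
    (t : T) (ht : p₁ t ∈ Set.range X₁.incl) : p₂ t ∈ Set.range X₂.incl := by
  let V : T.Opens := p₁ ⁻¹ᵁ X₁.incl.opensRange
  have hV : Set.range (V.ι ≫ p₁) ⊆ Set.range X₁.incl := by
    rintro _ ⟨v, rfl⟩
    exact v.2
  have hjV : Set.range j ⊆ Set.range V.ι := by
    rintro _ ⟨u, rfl⟩
    rw [Scheme.Opens.range_ι]
    exact ⟨u, congr($hj₁ u).symm⟩
  let a : V.toScheme ⟶ U := IsOpenImmersion.lift X₁.incl (V.ι ≫ p₁) hV
  let b : U ⟶ V.toScheme := IsOpenImmersion.lift V.ι j hjV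
  have ha : a ≫ X₁.incl = V.ι ≫ p₁ := IsOpenImmersion.lift_fac _ _ _
  have hb : b ≫ V.ι = j := IsOpenImmersion.lift_fac _ _ _
  have hba : b ≫ a = 𝟙 U := by
    rw [← cancel_mono X₁.incl, Category.assoc, ha, reassoc_of% hb, hj₁, Category.id_comp]
  have : IsDominant (b ≫ V.ι) := hb ▸ inferInstance
  have : IsDominant b := IsDominant.of_comp_of_isOpenImmersion b V.ι
  have h : a ≫ X₂.incl = V.ι ≫ p₂ := by
    refine ext_of_isDominant_of_isSeparated X₂.str ?_ b ?_
    · rw [Category.assoc, X₂.incl_comp_str, Category.assoc, ← hp, ← reassoc_of% ha,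
        X₁.incl_comp_str]
    · rw [reassoc_of% hba, reassoc_of% hb, hj₂]
  exact ⟨a ⟨t, ht⟩, congr($h ⟨t, ht⟩)⟩

/-- The multiples of the boundary divisor are cofinal among the divisors supported in it. -/
lemma exists_boundaryDivisor_comap_le {X₁ X₂ : NormalCompactification s} {T : Scheme.{u}}
    [CompactSpace T] (p₁ : T ⟶ X₁.X) (p₂ : T ⟶ X₂.X)
    (hp : ∀ t, p₂ t ∈ Set.range X₂.incl → p₁ t ∈ Set.range X₁.incl) (D : X₁.BoundaryDivisor) :
    ∃ E : X₂.BoundaryDivisor, E.ideal.comap p₂ ≤ D.ideal.comap p₁ := by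
  obtain ⟨I, hI, hsupp⟩ := X₂.boundary
  obtain ⟨n, hn⟩ := (hI.isLocallyPrincipal.comap p₂).exists_pow_le (J := D.ideal.comap p₁) (by
    rw [Scheme.IdealSheafData.support_comap, Scheme.IdealSheafData.support_comap]
    intro t ht
    change p₂ t ∈ (I.support : Set X₂.X)
    rw [hsupp]
    exact fun h => D.support_subset ht (hp t h))
  refine ⟨⟨I ^ n, hI.pow n, ?_⟩, by rw [comap_pow]; exact hn⟩
  rw [← hsupp]
  -- For `n = 0` the divisor is zero and its support is empty; only for `n > 0` is the support that
  -- of `I`.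
  cases n with
  | zero => simp
  | succ n => simp

instance (X : NormalCompactification s) : Nonempty X.BoundaryDivisor := by
  obtain ⟨I, hI, hsupp⟩ := X.boundary
  exact ⟨I, hI, hsupp.le⟩

instance (X : NormalCompactification s) : IsDirectedOrder X.BoundaryDivisor where
  directed D E := by
    refine ⟨⟨D.ideal * E.ideal, D.isEffectiveCartier.mul E.isEffectiveCartier, ?_⟩, ?_, ?_⟩
    · rw [Scheme.IdealSheafData.support_mul]
      exact Set.union_subset D.support_subset E.support_subset
    · exact fun V => Ideal.mul_le_left
    · exact fun V => Ideal.mul_le_right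

/-- The pullback of a boundary divisor along a morphism of compactifications. -/
def BoundaryDivisor.pullback {X₁ X₂ : NormalCompactification s} (f : X₂.X ⟶ X₁.X)
    (hU : X₂.incl ≫ f = X₁.incl) (D : X₁.BoundaryDivisor) :
    X₂.BoundaryDivisor :=
  have h : ((D.ideal.comap f).support : Set X₂.X) ⊆ (Set.range X₂.incl)ᶜ := by
    rw [Scheme.IdealSheafData.support_comap]
    rintro _ hx ⟨u, rfl⟩
    exact D.support_subset hx ⟨u, congr($hU u).symm⟩
  { ideal := D.ideal.comap f
    isEffectiveCartier := by
      -- Regularity of the pulled back equation comes from comparison with the boundary divisor of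
      -- `X₂`.
      obtain ⟨I, hI, hsupp⟩ := X₂.boundary
      refine hI.of_isLocallyPrincipal (D.isEffectiveCartier.isLocallyPrincipal.comap f) ?_
      change ((D.ideal.comap f).support : Set X₂.X) ⊆ I.support
      rw [hsupp]
      exact h
    support_subset := h }

/-- The case `T = X₂` with the roles of `X₁` and `X₂` exchanged; it needs that `f` maps no boundary
point into `U`. -/
lemma exists_le_pullback {X₁ X₂ : NormalCompactification s} (f : X₂.X ⟶ X₁.X)
    (hf : f ≫ X₁.str = X₂.str) (hU : X₂.incl ≫ f = X₁.incl) (E : X₂.BoundaryDivisor) :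
    ∃ D : X₁.BoundaryDivisor, E ≤ D.pullback f hU := by
  obtain ⟨D, hD⟩ := exists_boundaryDivisor_comap_le (𝟙 X₂.X) f
    (mem_range_incl_of_mem_range_incl X₂.incl f (𝟙 X₂.X) (by rw [hf, Category.id_comp]) hU
        (Category.comp_id _)) E
  rw [Scheme.IdealSheafData.comap_id] at hD
  exact ⟨D, hD⟩

variable [LocallyOfFiniteType s] [QuasiCompact s]

lemma relations_le_of_comap_le {X₁ X₂ : NormalCompactification s}
    {T : Scheme.{u}} (j : U ⟶ T) (p₁ : T ⟶ X₁.X) (p₂ : T ⟶ X₂.X)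
    [UniversallyClosed (p₁ ≫ X₁.str)] (hj₁ : j ≫ p₁ = X₁.incl) (hj₂ : j ≫ p₂ = X₂.incl)
    (hp : ∀ t, p₂ t ∈ Set.range X₂.incl → p₁ t ∈ Set.range X₁.incl)
    {D : X₁.BoundaryDivisor} {E : X₂.BoundaryDivisor}
    (hI : E.ideal.comap p₂ ≤ D.ideal.comap p₁) : relations E ≤ relations D :=
  iSup_mono fun C => AddSubgroup.map_mono
    (congruenceSubgroup_le_of_comap_le j p₁ p₂ hj₁ hj₂ hp hI C)

/-- The common model `T` is the scheme-theoretic image of `U` in `X₁ × X₂`: closed in the product,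
hence proper over `k`, and reduced with `U` dense. -/
lemma exists_relations_le [IsReduced U] (X₁ X₂ : NormalCompactification s)
    (D : X₁.BoundaryDivisor) : ∃ E : X₂.BoundaryDivisor, relations E ≤ relations D := by
  obtain ⟨g, hg₁, hg₂⟩ : ∃ g : U ⟶ Limits.pullback X₁.str X₂.str,
      g ≫ Limits.pullback.fst _ _ = X₁.incl ∧ g ≫ Limits.pullback.snd _ _ = X₂.incl :=
    ⟨Limits.pullback.lift X₁.incl X₂.incl (by rw [X₁.incl_comp_str, X₂.incl_comp_str]),
      Limits.pullback.lift_fst _ _ _, Limits.pullback.lift_snd _ _ _⟩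
  let str : Limits.pullback X₁.str X₂.str ⟶ Spec (.of k) := Limits.pullback.fst _ _ ≫ X₁.str
  have : IsSeparated str := inferInstance
  have : QuasiCompact (g ≫ str) := by
    have : g ≫ str = s := ((reassoc_of% hg₁) X₁.str).trans X₁.incl_comp_str
    rw [this]
    infer_instance
  have : QuasiCompact g := QuasiCompact.of_comp g str
  have := isReduced_image g
  let p₁ : g.image ⟶ X₁.X := g.imageι ≫ Limits.pullback.fst _ _
  let p₂ : g.image ⟶ X₂.X := g.imageι ≫ Limits.pullback.snd _ _
  have h₁ : g.toImage ≫ p₁ = X₁.incl := by simp [p₁, hg₁]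
  have h₂ : g.toImage ≫ p₂ = X₂.incl := by simp [p₂, hg₂]
  have hp : p₂ ≫ X₂.str = p₁ ≫ X₁.str := by simp [p₁, p₂, Limits.pullback.condition]
  have hrange := mem_range_incl_of_mem_range_incl g.toImage p₂ p₁ hp h₂ h₁
  have : CompactSpace g.image := QuasiCompact.compactSpace_of_compactSpace (p₁ ≫ X₁.str)
  obtain ⟨E, hE⟩ := exists_boundaryDivisor_comap_le p₁ p₂ hrange D
  exact ⟨E, relations_le_of_comap_le g.toImage p₁ p₂ h₁ h₂ hrange hE⟩

/-- On `T = X₂` the two ideals are equal, so the comparison of relations applies in both directions.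
-/
lemma relations_pullback {X₁ X₂ : NormalCompactification s} (f : X₂.X ⟶ X₁.X)
    (hf : f ≫ X₁.str = X₂.str) (hU : X₂.incl ≫ f = X₁.incl) (D : X₁.BoundaryDivisor) :
    relations (D.pullback f hU) = relations D := by
  have : UniversallyClosed (f ≫ X₁.str) := hf ▸ inferInstance
  have : UniversallyClosed (𝟙 X₂.X ≫ X₂.str) := (Category.id_comp X₂.str).symm ▸ inferInstance
  have h : (D.pullback f hU).ideal.comap (𝟙 X₂.X) = D.ideal.comap f :=
    Scheme.IdealSheafData.comap_id _
  refine le_antisymm ?_ ?_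
  · exact relations_le_of_comap_le X₂.incl f (𝟙 X₂.X) hU (Category.comp_id _)
      (fun t ⟨u, hu⟩ => ⟨u, by rw [← hU]; exact congr(f $hu)⟩) h.le
  · exact relations_le_of_comap_le X₂.incl (𝟙 X₂.X) f (Category.comp_id _) hU
      (mem_range_incl_of_mem_range_incl X₂.incl f (𝟙 X₂.X) (by rw [hf, Category.id_comp]) hU
        (Category.comp_id _)) h.ge

end NormalCompactification

/-! ### Comparison of class groups -/

namespace NormalCompactification

variable {k : Type u} [Field k] {U : Scheme.{u}} {s : U ⟶ Spec (.of k)}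
variable [LocallyOfFiniteType s] [QuasiCompact s] {X X₁ X₂ X₃ : NormalCompactification s}

namespace RelChow

lemma mk_surjective (D : X.BoundaryDivisor) : Function.Surjective (mk D) :=
  QuotientAddGroup.mk'_surjective _

/-- The canonical map `C(X₂,E) → C(X₁,D)` if the relations of `E` are contained in those of `D`. -/
def comparison {E : X₂.BoundaryDivisor} {D : X₁.BoundaryDivisor}
    (h : relations E ≤ relations D) : RelChow E →+ RelChow D :=
  QuotientAddGroup.map (relations E) (relations D) (AddMonoidHom.id _) h

@[simp]
lemma comparison_mk {E : X₂.BoundaryDivisor} {D : X₁.BoundaryDivisor}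
    (h : relations E ≤ relations D) (z : ZeroCycle U) : comparison h (mk E z) = mk D z :=
  rfl

@[simp]
lemma comparison_self {D : X.BoundaryDivisor} (h : relations D ≤ relations D) (x : RelChow D) :
    comparison h x = x := by
  obtain ⟨z, rfl⟩ := mk_surjective D x
  rfl

lemma comparison_comparison {F : X₃.BoundaryDivisor} {E : X₂.BoundaryDivisor}
    {D : X₁.BoundaryDivisor} (h : relations F ≤ relations E) (h' : relations E ≤ relations D)
    (x : RelChow F) : comparison h' (comparison h x) = comparison (h.trans h') x := by
  obtain ⟨z, rfl⟩ := mk_surjective F x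
  simp only [comparison_mk]

lemma transition_eq {D E : X.BoundaryDivisor} (h : D ≤ E) :
    transition h = comparison (relations_anti h) :=
  rfl

@[simp]
lemma transition_mk {D E : X.BoundaryDivisor} (h : D ≤ E) (z : ZeroCycle U) :
    transition h (mk E z) = mk D z :=
  rfl

/-- The isomorphism `C(X₂,E) ≅ C(X₁,D)` if the relations of `E` and `D` agree. -/
def congr {E : X₂.BoundaryDivisor} {D : X₁.BoundaryDivisor}
    (h : relations E = relations D) : RelChow E ≃+ RelChow D where
  toFun := comparison h.le
  invFun := comparison h.ge
  left_inv x := by rw [comparison_comparison, comparison_self]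
  right_inv x := by rw [comparison_comparison, comparison_self]
  map_add' := map_add _

lemma congr_apply {E : X₂.BoundaryDivisor} {D : X₁.BoundaryDivisor}
    (h : relations E = relations D) (x : RelChow E) : congr h x = comparison h.le x :=
  rfl

end RelChow

namespace ClassGroup

open RelChow

/-- Both components come from one cycle representing `c` at a common upper bound of `E` and `E'`;
this makes `map` independent of choices. -/
lemma comparison_eq (c : X₂.ClassGroup) {E E' : X₂.BoundaryDivisor} {D : X₁.BoundaryDivisor}
    (h : relations E ≤ relations D) (h' : relations E' ≤ relations D) :
    comparison h (c.1 E) = comparison h' (c.1 E') := by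
  obtain ⟨F, hF, hF'⟩ := exists_ge_ge E E'
  obtain ⟨z, hz⟩ := mk_surjective F (c.1 F)
  rw [← c.2 hF, ← c.2 hF', ← hz, transition_mk, transition_mk, comparison_mk, comparison_mk]

/-- The map `C(U ⊂ X₂) → C(U ⊂ X₁)` if every relation group of `X₁` contains one of `X₂`. -/
def map (h : ∀ D : X₁.BoundaryDivisor, ∃ E : X₂.BoundaryDivisor, relations E ≤ relations D) :
    X₂.ClassGroup →+ X₁.ClassGroup where
  toFun c := ⟨fun D => comparison (h D).choose_spec (c.1 (h D).choose), fun D D' hD => by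
    rw [transition_eq, comparison_comparison]
    exact comparison_eq c _ _⟩
  map_zero' := Subtype.ext (funext fun _ => map_zero _)
  map_add' _ _ := Subtype.ext (funext fun _ => map_add _ _ _)

lemma map_apply
    (h : ∀ D : X₁.BoundaryDivisor, ∃ E : X₂.BoundaryDivisor, relations E ≤ relations D)
    (c : X₂.ClassGroup) {E : X₂.BoundaryDivisor} {D : X₁.BoundaryDivisor}
    (hle : relations E ≤ relations D) : (map h c).1 D = comparison hle (c.1 E) :=
  comparison_eq c _ _

lemma continuous_map
    (h : ∀ D : X₁.BoundaryDivisor, ∃ E : X₂.BoundaryDivisor, relations E ≤ relations D) :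
    Continuous (map h) :=
  Continuous.subtype_mk (continuous_pi fun D =>
    (continuous_of_discreteTopology (f := comparison (h D).choose_spec)).comp
      ((continuous_apply _).comp continuous_subtype_val)) _

lemma map_cycleClass
    (h : ∀ D : X₁.BoundaryDivisor, ∃ E : X₂.BoundaryDivisor, relations E ≤ relations D)
    (z : ZeroCycle U) : map h (X₂.cycleClass z) = X₁.cycleClass z :=
  Subtype.ext (funext fun D => comparison_mk (h D).choose_spec z)

lemma map_map (h : ∀ D : X₁.BoundaryDivisor, ∃ E : X₂.BoundaryDivisor, relations E ≤ relations D)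
    (h' : ∀ E : X₂.BoundaryDivisor, ∃ D : X₁.BoundaryDivisor, relations D ≤ relations E)
    (c : X₂.ClassGroup) : map h' (map h c) = c := by
  refine Subtype.ext (funext fun E => ?_)
  obtain ⟨D, hD⟩ := h' E
  obtain ⟨F, hF⟩ := h D
  rw [map_apply h' _ hD, map_apply h _ hF, comparison_comparison,
    comparison_eq c (hF.trans hD) le_rfl, comparison_self]

/-- The class groups agree if the relation groups are mutually cofinal. -/
def congr (h : ∀ D : X₁.BoundaryDivisor, ∃ E : X₂.BoundaryDivisor, relations E ≤ relations D)
    (h' : ∀ E : X₂.BoundaryDivisor, ∃ D : X₁.BoundaryDivisor, relations D ≤ relations E) :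
    X₂.ClassGroup ≃ₜ+ X₁.ClassGroup where
  toFun := map h
  invFun := map h'
  left_inv := map_map h h'
  right_inv := map_map h' h
  map_add' := map_add _
  continuous_toFun := continuous_map h
  continuous_invFun := continuous_map h'

lemma congr_apply
    (h : ∀ D : X₁.BoundaryDivisor, ∃ E : X₂.BoundaryDivisor, relations E ≤ relations D)
    (h' : ∀ E : X₂.BoundaryDivisor, ∃ D : X₁.BoundaryDivisor, relations D ≤ relations E)
    (c : X₂.ClassGroup) : congr h h' c = map h c :=
  rfl

/-- A basic neighbourhood constrains finitely many components, all determined by the component at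
one larger divisor `F`, which is the class of a cycle. -/
lemma denseRange_cycleClass (X : NormalCompactification s) : DenseRange X.cycleClass := by
  intro c
  rw [mem_closure_iff_nhds]
  intro t ht
  rw [nhds_subtype, Filter.mem_comap] at ht
  obtain ⟨t', ht', hsub⟩ := ht
  rw [nhds_pi, Filter.mem_pi] at ht'
  obtain ⟨S, hS, V, hV, hSV⟩ := ht'
  obtain ⟨F, hF⟩ := hS.toFinset.exists_le
  obtain ⟨z, hz⟩ := mk_surjective F (c.1 F)
  refine ⟨X.cycleClass z, hsub (hSV fun D hD => ?_), z, rfl⟩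
  have h : (X.cycleClass z).1 D = c.1 D := by
    rw [← c.2 (hF D (hS.mem_toFinset.mpr hD)), ← hz, transition_mk]
    rfl
  rw [h]
  exact mem_of_mem_nhds (hV D)

end ClassGroup

end NormalCompactification

end CycleClass

end

theorem mainTheorem9 {k : Type u} [Field k] [Finite k] {U : Scheme.{u}} (s : U ⟶ Spec (.of k))
    [IsIntegral U] [Smooth s] [IsSeparated s] [QuasiCompact s] :
    (∀ X₁ X₂ : CycleClass.NormalCompactification s,
      ∃! e : X₁.ClassGroup ≃ₜ+ X₂.ClassGroup,
        ∀ z : CycleClass.ZeroCycle U, e (X₁.cycleClass z) = X₂.cycleClass z) ∧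
    (∀ (X₁ X₂ : CycleClass.NormalCompactification s) (f : X₂.X ⟶ X₁.X),
      f ≫ X₁.str = X₂.str → X₂.incl ≫ f = X₁.incl →
      ∃ pull : X₁.BoundaryDivisor → X₂.BoundaryDivisor,
        (∀ D, (pull D).ideal = D.ideal.comap f) ∧
        (∀ E, ∃ D, E ≤ pull D) ∧
        ∃ push : ∀ D : X₁.BoundaryDivisor,
            CycleClass.NormalCompactification.RelChow (pull D) ≃+
              CycleClass.NormalCompactification.RelChow D,
          (∀ D z, push D (CycleClass.NormalCompactification.RelChow.mk (pull D) z) =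
            CycleClass.NormalCompactification.RelChow.mk D z) ∧
          ∃ e : X₂.ClassGroup ≃ₜ+ X₁.ClassGroup, ∀ c D, (e c).1 D = push D (c.1 (pull D))) := by
  open CycleClass CycleClass.NormalCompactification in
  refine ⟨fun X₁ X₂ => ⟨ClassGroup.congr (exists_relations_le X₂ X₁) (exists_relations_le X₁ X₂),
    fun z => ?_, fun e he => ?_⟩, fun X₁ X₂ f hf hU => ?_⟩
  · rw [ClassGroup.congr_apply, ClassGroup.map_cycleClass]
  · refine ContinuousAddEquiv.ext (congrFun ((ClassGroup.denseRange_cycleClass X₁).equalizer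
      e.continuous_toFun (ContinuousAddEquiv.continuous_toFun _) (funext fun z => ?_)))
    refine (he z).trans ?_
    change _ = ClassGroup.congr _ _ _
    rw [ClassGroup.congr_apply, ClassGroup.map_cycleClass]
  · have h (D : X₁.BoundaryDivisor) := relations_pullback f hf hU D
    refine ⟨fun D => D.pullback f hU, fun _ => rfl, exists_le_pullback f hf hU,
      fun D => RelChow.congr (h D), fun D z => ?_,
      ClassGroup.congr (fun D => ⟨_, (h D).le⟩) (fun E => ?_), fun c D => ?_⟩
    · rw [RelChow.congr_apply, RelChow.comparison_mk]
    · obtain ⟨D, hD⟩ := exists_le_pullback f hf hU E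
      exact ⟨D, (h D).ge.trans (relations_anti hD)⟩
    · rw [ClassGroup.congr_apply, RelChow.congr_apply, ClassGroup.map_apply _ _ (h D).le]
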